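/- For a positive integer $n$ let $\Omega(n)$ be the number of prime factors of $n$ counted with multiplicity. The Dirichlet series $$L(s)=\sum_{n=1}^{\infty}\Big(\frac23\Big)^{\Omega(n)}n^{-s}$$ converges absolutely and is holomorphic for $\mathrm{Re}(s)>1$, where $L(s)=\prod_{p\text{ prime}}\left(1-\frac23p^{-s}\right)^{-1}$. The product $$P=\prod_{p\text{ prime}}\left(1-\frac53p^{-2}+\frac{10}{27}p^{-3}+\frac{20}{27}p^{-4}-\frac{8}{27}p^{-5}\right)$$ converges unconditionally and $P>0$. Put $A=\left(\zeta(2)^2P\right)^{-1/3}$, where $\zeta$ is the Riemann zeta function. The function $L(s)^3$ has a meromorphic continuation to $\mathrm{Re}(s)>\frac12$, which is holomorphic except for a pole of order $2$ at $s=1$, with $\lim_{s\to1}L(s)^3(s-1)^2=A^3$. Moreover, as $X\to+\infty$, $$\sum_{1\le n\le X}\Big(\frac23\Big)^{\Omega(n)}\sim\frac{A}{\Gamma(2/3)}\cdot\frac{X}{(\log X)^{1/3}},$$ that is, the ratio of the two sides tends to $1$. -/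

import Mathlib

open Filter Topology Asymptotics

noncomputable section

/-- The coefficient `(2/3)^Ω(n)`, where `Ω(n)` counts the prime factors of `n` with multiplicity.
(The value at `n = 0` is never used: Dirichlet series and the partial sums start at `n = 1`.) -/
def omegaCoeff (n : ℕ) : ℝ := (2 / 3 : ℝ) ^ (ArithmeticFunction.cardFactors n)

/-- The Dirichlet series `L(s) = ∑_{n ≥ 1} (2/3)^Ω(n) n^{-s}`. -/
def omegaL (s : ℂ) : ℂ := LSeries (fun n => (omegaCoeff n : ℂ)) s

/-- The factor `1 - (5/3) p⁻² + (10/27) p⁻³ + (20/27) p⁻⁴ - (8/27) p⁻⁵`. -/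
def eulerFactor (p : Nat.Primes) : ℝ :=
  1 - 5 / 3 * ((p : ℕ) : ℝ)⁻¹ ^ 2 + 10 / 27 * ((p : ℕ) : ℝ)⁻¹ ^ 3
    + 20 / 27 * ((p : ℕ) : ℝ)⁻¹ ^ 4 - 8 / 27 * ((p : ℕ) : ℝ)⁻¹ ^ 5

/-- The constant `A = (ζ(2)² ∏_p eulerFactor p)^{-1/3}` (`ζ(2)` is real). -/
def constA : ℝ := ((riemannZeta 2).re ^ 2 * ∏' p : Nat.Primes, eulerFactor p) ^ (-(1 / 3) : ℝ)

end

/-!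
The local factors of `L³` and `ζ²` at a prime agree to first order in `p⁻ˢ`, so `L³ = ζ² H` where the
Euler product `H = correctionProd` converges on `Re s > 1/2`. The meromorphic continuation, the
double pole at `1` and the value `A³ = H(1)` are read off from this identity
(`omegaL_pow_three`, `correctionProd_one`, `exists_meromorphic_continuation`).

The asymptotic formula does not need the behaviour of the cube root `L` near the line `Re s = 1`, only
that of `L(s)` for real `s → 1⁺`, where `(s - 1)^{2/3} L(s) → A`, and the prime number theorem. Write
`f(n) = (2/3)^Ω(n)`.

* Karamata's Tauberian theorem turns the limit on the real axis into
  `∑_{n ≤ x} f(n)/n ~ A / Γ(5/3) · (log x)^{2/3}` (`tendsto_sum_omegaCoeff_div`).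
* Since `f` is completely multiplicative, `f log` is the Dirichlet convolution of `f` and `f Λ`, hence
  `∑_{n ≤ x} f(n) log n = ∑_{m ≤ x} f(m) ψ_f(x / m)` with `ψ_f(y) = ∑_{n ≤ y} f(n) Λ(n)`. The prime
  number theorem gives `ψ_f(y) ~ (2/3) y`, so that the right-hand side is asymptotic to
  `(2/3) x ∑_{m ≤ x} f(m)/m`. Replacing `log n` by `log x` on the left costs only `O(x)`, and the
  claim follows on dividing by `log x` (`tendsto_sum_omegaCoeff_mul_log`).

The prime number theorem itself is derived from the continuity of `-ζ'/ζ - 1/(s - 1)` on `Re s ≥ 1`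
by the Wiener–Ikehara method. Chebyshev's bound makes `B(u) = ψ(eᵘ) e⁻ᵘ - 1` bounded, which allows the
passage to the boundary line in its Fejér averages; these tend to `0` by the Riemann–Lebesgue lemma,
and the monotonicity of `ψ` then forces `B → 0` (`tendsto_zero_of_laplace_continuousOn`).
-/

noncomputable section

open MeasureTheory

/-! ### A Tauberian theorem of Wiener–Ikehara type -/

/-- The Fejér kernel is the Fourier transform of the hat function `t ↦ 1 - |t|` on `[-1, 1]`. -/
lemma integral_hat_mul_cexp (y : ℝ) :
    ∫ t in (-1 : ℝ)..1, ((1 - |t| : ℝ) : ℂ) * Complex.exp (t * y * Complex.I) =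
      ((Real.sinc (y / 2) ^ 2 : ℝ) : ℂ) := by
  have hcont : Continuous fun t : ℝ => ((1 - |t| : ℝ) : ℂ) * Complex.exp (t * y * Complex.I) := by
    fun_prop
  rw [← intervalIntegral.integral_add_adjacent_intervals (b := 0)
    (hcont.intervalIntegrable _ _) (hcont.intervalIntegrable _ _)]
  -- both halves have the shape `∫ (1 - t) e^{itw}`, with `w = -y` and `w = y`
  have half : ∀ w : ℝ, w ≠ 0 → ∫ t in (0 : ℝ)..1, ((1 - t : ℝ) : ℂ) *
      Complex.exp (t * w * Complex.I) =
      (Complex.exp (w * Complex.I) - 1) / (w * Complex.I) ^ 2 - 1 / (w * Complex.I) := by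
    intro w hw
    have hw' : (w : ℂ) * Complex.I ≠ 0 := by simp [hw]
    have hd : ∀ t ∈ Set.uIcc (0 : ℝ) 1, HasDerivAt (fun t : ℝ =>
        ((1 - t : ℝ) : ℂ) * Complex.exp (t * w * Complex.I) / (w * Complex.I)
          + Complex.exp (t * w * Complex.I) / (w * Complex.I) ^ 2)
        (((1 - t : ℝ) : ℂ) * Complex.exp (t * w * Complex.I)) t := by
      intro t _
      have h1 : HasDerivAt (fun t : ℝ => ((1 - t : ℝ) : ℂ)) (((-1 : ℝ)) : ℂ) t :=
        ((hasDerivAt_id t).const_sub 1).ofReal_comp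
      have h2 : HasDerivAt (fun t : ℝ => Complex.exp (t * w * Complex.I))
          (Complex.exp (t * w * Complex.I) * (w * Complex.I)) t := by
        have h3 : HasDerivAt (fun t : ℝ => ((t : ℂ) * w * Complex.I)) (w * Complex.I) t := by
          have := ((hasDerivAt_id t).ofReal_comp.mul_const ((w : ℂ) * Complex.I))
          simpa [mul_assoc] using this
        exact h3.cexp
      refine (((h1.mul h2).div_const (w * Complex.I)).add
        (h2.div_const ((w * Complex.I) ^ 2))).congr_deriv ?_
      generalize (w : ℂ) * Complex.I = c at *
      field_simp
      push_cast
      ring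
    rw [intervalIntegral.integral_eq_sub_of_hasDerivAt hd
      (Continuous.intervalIntegrable (by fun_prop) _ _)]
    simp
    field_simp
    ring
  have hneg : ∫ t in (-1 : ℝ)..0, ((1 - |t| : ℝ) : ℂ) * Complex.exp (t * y * Complex.I) =
      ∫ t in (0 : ℝ)..1, ((1 - t : ℝ) : ℂ) * Complex.exp (t * (-y : ℝ) * Complex.I) := by
    rw [← neg_zero, ← intervalIntegral.integral_comp_neg, neg_zero]
    refine intervalIntegral.integral_congr fun t ht => ?_
    simp only [Set.uIcc_of_le zero_le_one, Set.mem_Icc] at ht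
    simp [abs_of_nonneg ht.1]
  have hpos : ∫ t in (0 : ℝ)..1, ((1 - |t| : ℝ) : ℂ) * Complex.exp (t * y * Complex.I) =
      ∫ t in (0 : ℝ)..1, ((1 - t : ℝ) : ℂ) * Complex.exp (t * y * Complex.I) := by
    refine intervalIntegral.integral_congr fun t ht => ?_
    simp only [Set.uIcc_of_le zero_le_one, Set.mem_Icc] at ht
    simp [abs_of_nonneg ht.1]
  rw [hneg, hpos]
  rcases eq_or_ne y 0 with rfl | hy
  · have : ∫ t in (0 : ℝ)..1, ((1 - t : ℝ) : ℂ) = 1 / 2 := by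
      have h : ∫ t in (0 : ℝ)..1, (1 - t) = 1 / 2 := by
        rw [intervalIntegral.integral_sub (by simp) (by simp), integral_id]
        norm_num
      rw [intervalIntegral.integral_ofReal, h]
      norm_num
    simp only [neg_zero, Complex.ofReal_zero, mul_zero, zero_mul, Complex.exp_zero, mul_one, this]
    norm_num
  · rw [half _ (neg_ne_zero.mpr hy), half _ hy, Real.sinc_of_ne_zero (by simpa using hy)]
    have hy' : (y : ℂ) ≠ 0 := by simpa using hy
    have hc : Complex.exp (y * Complex.I) + Complex.exp (((-y : ℝ) : ℂ) * Complex.I) =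
        2 - 4 * Complex.sin (y / 2) ^ 2 := by
      have := Complex.two_cos (y : ℂ)
      push_cast
      rw [← this, show (y : ℂ) = 2 * (y / 2) by ring, Complex.cos_two_mul,
        ← sub_eq_zero, Complex.cos_sq']
      ring_nf
    have hI : Complex.I ^ 2 = -1 := Complex.I_sq
    have : (Complex.exp (((-y : ℝ) : ℂ) * Complex.I) - 1) / (((-y : ℝ) : ℂ) * Complex.I) ^ 2 -
        1 / (((-y : ℝ) : ℂ) * Complex.I) +
        ((Complex.exp (y * Complex.I) - 1) / (y * Complex.I) ^ 2 - 1 / (y * Complex.I)) =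
        (2 - (Complex.exp (y * Complex.I) + Complex.exp (((-y : ℝ) : ℂ) * Complex.I))) / y ^ 2 := by
      rw [mul_pow, mul_pow, hI]
      push_cast
      field_simp
      ring
    rw [this, hc]
    push_cast
    field_simp
    ring

lemma integrable_sinc_half_sq : Integrable fun y : ℝ => Real.sinc (y / 2) ^ 2 := by
  refine ((integrable_inv_one_add_sq).const_mul 5).mono'
    (by fun_prop) (Eventually.of_forall fun y => ?_)
  have h1 : Real.sinc (y / 2) ^ 2 ≤ 1 := by
    rw [sq_le_one_iff_abs_le_one]; exact Real.abs_sinc_le_one _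
  have h2 : y ^ 2 * Real.sinc (y / 2) ^ 2 ≤ 4 := by
    rcases eq_or_ne y 0 with rfl | hy
    · simp
    · rw [Real.sinc_of_ne_zero (by simpa using hy)]
      have := Real.sin_sq_le_one (y / 2)
      have : y ^ 2 * (Real.sin (y / 2) / (y / 2)) ^ 2 = 4 * Real.sin (y / 2) ^ 2 := by
        field_simp; ring
      linarith
  rw [Real.norm_of_nonneg (by positivity), ← div_eq_mul_inv, le_div_iff₀ (by positivity)]
  nlinarith

lemma integral_sinc_half_sq_pos : 0 < ∫ y : ℝ, Real.sinc (y / 2) ^ 2 := by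
  rw [integral_pos_iff_support_of_nonneg (fun _ => sq_nonneg _) integrable_sinc_half_sq]
  have hc : Continuous fun y : ℝ => Real.sinc (y / 2) ^ 2 := by fun_prop
  exact (hc.isOpen_support).measure_pos _ ⟨0, by simp⟩

/-- The Fourier step of the Wiener–Ikehara method: if the Laplace transform of a bounded `B` extends
continuously to the closed right half-plane, the Fejér averages of `B` tend to `0`. On the line
`Re z = ε` the average is a Fourier integral of the transform over a compact interval;
letting `ε → 0` the Riemann–Lebesgue lemma applies to the boundary values. -/
theorem tendsto_integral_fejer_of_laplace {B : ℝ → ℝ} {C : ℝ} {g : ℂ → ℂ} (hBm : Measurable B)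
    (hB : ∀ u, |B u| ≤ C) (hB0 : ∀ u < 0, B u = 0) (hg : ContinuousOn g {z | 0 ≤ z.re})
    (hL : ∀ z : ℂ, 0 < z.re → ∫ u in Set.Ioi (0 : ℝ), (B u : ℂ) * Complex.exp (-z * u) = g z) :
    Tendsto (fun x : ℝ => ∫ y : ℝ, B (x - y) * Real.sinc (y / 2) ^ 2) atTop (𝓝 0) := by
  -- the average on the line `Re z = ε`
  have hfub : ∀ x ε : ℝ, 0 < ε →
      ∫ t in (-1 : ℝ)..1, ((1 - |t| : ℝ) : ℂ) * Complex.exp (t * x * Complex.I) *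
        g (ε + t * Complex.I) =
      ∫ u in Set.Ioi (0 : ℝ), (B u : ℂ) * Complex.exp (-ε * u) *
        ((Real.sinc ((x - u) / 2) ^ 2 : ℝ) : ℂ) := by
    intro x ε hε
    rw [intervalIntegral.integral_of_le (by norm_num)]
    have e1 : ∀ t : ℝ, ((1 - |t| : ℝ) : ℂ) * Complex.exp (t * x * Complex.I) *
        g (ε + t * Complex.I) = ∫ u in Set.Ioi (0 : ℝ),
          ((1 - |t| : ℝ) : ℂ) * Complex.exp (t * x * Complex.I) *
            ((B u : ℂ) * Complex.exp (-(ε + t * Complex.I) * u)) := by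
      intro t
      rw [integral_const_mul, hL _ (by simpa using hε)]
    simp_rw [e1]
    rw [integral_integral_swap]
    · refine integral_congr_ae (Eventually.of_forall fun u => ?_)
      simp only
      rw [← integral_hat_mul_cexp, intervalIntegral.integral_of_le (by norm_num),
        ← integral_const_mul]
      refine integral_congr_ae (Eventually.of_forall fun t => ?_)
      simp only
      have : Complex.exp (t * x * Complex.I) * Complex.exp (-(ε + t * Complex.I) * u) =
          Complex.exp (-ε * u) * Complex.exp (t * ((x - u : ℝ) : ℂ) * Complex.I) := by
        rw [← Complex.exp_add, ← Complex.exp_add]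
        congr 1
        push_cast
        ring
      linear_combination ((1 - |t| : ℝ) : ℂ) * (B u : ℂ) * this
    · have hi : Integrable (fun u : ℝ => C * Real.exp (-ε * u))
          (volume.restrict (Set.Ioi (0 : ℝ))) :=
        (integrableOn_exp_mul_Ioi (by linarith) 0).const_mul C
      have h1 : Integrable (fun _ : ℝ => (1 : ℝ)) (volume.restrict (Set.Ioc (-1 : ℝ) 1)) :=
        integrable_const _
      refine (h1.mul_prod hi).mono' ?_ ?_
      · refine Measurable.aestronglyMeasurable ?_
        simp only [Function.uncurry_def]
        fun_prop
      · rw [Measure.prod_restrict]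
        filter_upwards [ae_restrict_mem (measurableSet_Ioc.prod measurableSet_Ioi)] with p hp
        obtain ⟨⟨h1, h2⟩, -⟩ := hp
        simp only [Function.uncurry, norm_mul, Complex.norm_exp, Complex.norm_real, one_mul]
        have e2 : (-((ε : ℂ) + p.1 * Complex.I) * p.2).re = -ε * p.2 := by simp
        have e3 : ((p.1 : ℂ) * x * Complex.I).re = 0 := by simp
        rw [e2, e3, Real.exp_zero, mul_one]
        have h4 : ‖1 - |p.1|‖ ≤ 1 := by
          rw [Real.norm_eq_abs, abs_le]
          constructor <;> linarith [abs_nonneg p.1, abs_le.mpr ⟨h1.le, h2⟩]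
        calc ‖1 - |p.1|‖ * (‖B p.2‖ * Real.exp (-ε * p.2))
            ≤ 1 * (C * Real.exp (-ε * p.2)) := by
              gcongr
              exact hB _
          _ = _ := one_mul _
  -- the average on the boundary line `Re z = 0`
  have hbdry : ∀ x : ℝ,
      ∫ t in (-1 : ℝ)..1, ((1 - |t| : ℝ) : ℂ) * Complex.exp (t * x * Complex.I) *
        g (t * Complex.I) =
      ((∫ y : ℝ, B (x - y) * Real.sinc (y / 2) ^ 2 : ℝ) : ℂ) := by
    intro x
    -- `g` is bounded on the compact rectangle `[0, 1] × [-1, 1]`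
    have hK : IsCompact (Set.Icc (0 : ℝ) 1 ×ˢ Set.Icc (-1 : ℝ) 1) :=
      isCompact_Icc.prod isCompact_Icc
    have hgc : ContinuousOn (fun p : ℝ × ℝ => g (p.1 + p.2 * Complex.I))
        (Set.Icc (0 : ℝ) 1 ×ˢ Set.Icc (-1 : ℝ) 1) := by
      refine hg.comp (by fun_prop) ?_
      rintro ⟨a, b⟩ ⟨ha, -⟩
      simpa using ha.1
    obtain ⟨D, hD⟩ := hK.exists_bound_of_continuousOn hgc
    have hseg : ∀ ε ∈ Set.Icc (0 : ℝ) 1, ContinuousOn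
        (fun t : ℝ => g (ε + t * Complex.I)) (Set.Icc (-1 : ℝ) 1) := fun ε hε =>
      hgc.comp (f := fun t : ℝ => (ε, t)) (by fun_prop) (fun t ht => ⟨hε, ht⟩)
    have l1 : Tendsto (fun ε : ℝ => ∫ t in (-1 : ℝ)..1,
        ((1 - |t| : ℝ) : ℂ) * Complex.exp (t * x * Complex.I) * g (ε + t * Complex.I)) (𝓝[>] 0)
        (𝓝 (∫ t in (-1 : ℝ)..1, ((1 - |t| : ℝ) : ℂ) * Complex.exp (t * x * Complex.I) *
          g (t * Complex.I))) := by
      refine intervalIntegral.tendsto_integral_filter_of_dominated_convergence (fun _ => D) ?_ ?_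
        (by simp) ?_
      · filter_upwards [Ioo_mem_nhdsGT (zero_lt_one (α := ℝ))] with ε hε
        refine ContinuousOn.aestronglyMeasurable ?_ measurableSet_uIoc
        rw [Set.uIoc_of_le (by norm_num)]
        exact ContinuousOn.mul (by fun_prop)
          ((hseg ε ⟨hε.1.le, hε.2.le⟩).mono Set.Ioc_subset_Icc_self)
      · filter_upwards [Ioo_mem_nhdsGT (zero_lt_one (α := ℝ))] with ε hε
        refine Eventually.of_forall fun t ht => ?_
        rw [Set.uIoc_of_le (by norm_num)] at ht
        have h4 : ‖1 - |t|‖ ≤ 1 := by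
          rw [Real.norm_eq_abs, abs_le]
          constructor <;> linarith [abs_nonneg t, abs_le.mpr ⟨ht.1.le, ht.2⟩]
        have e3 : ((t : ℂ) * x * Complex.I).re = 0 := by simp
        rw [norm_mul, norm_mul, Complex.norm_exp, Complex.norm_real, e3, Real.exp_zero, mul_one]
        have := hD (ε, t) ⟨⟨hε.1.le, hε.2.le⟩, ⟨ht.1.le, ht.2⟩⟩
        calc _ ≤ 1 * D := by gcongr
          _ = D := one_mul D
      · refine Eventually.of_forall fun t ht => Tendsto.const_mul _ ?_
        have h0 : ContinuousWithinAt g {z | 0 ≤ z.re} (t * Complex.I) := hg _ (by simp)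
        refine h0.tendsto.comp (tendsto_nhdsWithin_iff.mpr ⟨?_, ?_⟩)
        · have : Continuous fun ε : ℝ => (ε : ℂ) + t * Complex.I := by fun_prop
          simpa using (this.tendsto 0).mono_left nhdsWithin_le_nhds
        · filter_upwards [self_mem_nhdsWithin] with ε (hε : 0 < ε)
          simpa using hε.le
    -- the integrand on the other side is dominated since `B` is bounded
    have hint : Integrable (fun u : ℝ => C * Real.sinc ((x - u) / 2) ^ 2) :=
      (integrable_sinc_half_sq.comp_sub_left x).const_mul C
    have l2 : Tendsto (fun ε : ℝ => ∫ u in Set.Ioi (0 : ℝ), (B u : ℂ) * Complex.exp (-ε * u) *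
        ((Real.sinc ((x - u) / 2) ^ 2 : ℝ) : ℂ)) (𝓝[>] 0)
        (𝓝 (∫ u in Set.Ioi (0 : ℝ), (B u : ℂ) * ((Real.sinc ((x - u) / 2) ^ 2 : ℝ) : ℂ))) := by
      refine tendsto_integral_filter_of_dominated_convergence
        (fun u => C * Real.sinc ((x - u) / 2) ^ 2) ?_ ?_ hint.integrableOn ?_
      · exact Eventually.of_forall fun ε => Measurable.aestronglyMeasurable (by fun_prop)
      · filter_upwards [self_mem_nhdsWithin] with ε (hε : 0 < ε)
        filter_upwards [ae_restrict_mem measurableSet_Ioi] with u (hu : 0 < u)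
        rw [norm_mul, norm_mul, Complex.norm_exp, Complex.norm_real, Complex.norm_real,
          Real.norm_of_nonneg (sq_nonneg _)]
        have e : (-(ε : ℂ) * u).re = -(ε * u) := by simp
        have : Real.exp (-(ε * u)) ≤ 1 := Real.exp_le_one_iff.mpr (by nlinarith)
        rw [e]
        have h3 := hB u
        have h0 := (abs_nonneg _).trans h3
        calc _ ≤ C * 1 * Real.sinc ((x - u) / 2) ^ 2 := by
              gcongr
              exact h3
          _ = _ := by ring
      · refine Eventually.of_forall fun u => ?_
        have : Continuous fun ε : ℝ => (B u : ℂ) * Complex.exp (-ε * u) *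
          ((Real.sinc ((x - u) / 2) ^ 2 : ℝ) : ℂ) := by fun_prop
        simpa using (this.tendsto 0).mono_left nhdsWithin_le_nhds
    have l3 := l1.congr' (f₂ := fun ε : ℝ => ∫ u in Set.Ioi (0 : ℝ), (B u : ℂ) *
        Complex.exp (-ε * u) * ((Real.sinc ((x - u) / 2) ^ 2 : ℝ) : ℂ))
      (by filter_upwards [self_mem_nhdsWithin] with ε hε using hfub x ε hε)
    rw [tendsto_nhds_unique l3 l2]
    have e4 : ∫ y : ℝ, B (x - y) * Real.sinc (y / 2) ^ 2 =
        ∫ u : ℝ, B u * Real.sinc ((x - u) / 2) ^ 2 := by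
      rw [← integral_sub_left_eq_self _ volume x]
      simp
    rw [e4, ← integral_complex_ofReal]
    push_cast
    apply setIntegral_eq_integral_of_ae_compl_eq_zero
    have h0 : ∀ᵐ u : ℝ, u ≠ 0 := by simp [ae_iff]
    filter_upwards [h0] with u hu hu'
    have : u < 0 := lt_of_le_of_ne (by simpa using hu') hu
    simp [hB0 u this]
  -- Riemann–Lebesgue on the boundary line
  have hRL := (Real.tendsto_integral_exp_smul_cocompact
    (Set.indicator (Set.Ioc (-1 : ℝ) 1) fun t : ℝ => ((1 - |t| : ℝ) : ℂ) * g (t * Complex.I)))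
  have hx : Tendsto (fun x : ℝ => -(x / (2 * Real.pi))) atTop (cocompact ℝ) :=
    (tendsto_neg_atTop_atBot.comp
      (tendsto_id.atTop_div_const (by positivity))).mono_right atBot_le_cocompact
  have hlim : Tendsto (fun x : ℝ => ((∫ y : ℝ, B (x - y) * Real.sinc (y / 2) ^ 2 : ℝ) : ℂ))
      atTop (𝓝 0) := by
    refine (hRL.comp hx).congr fun x => ?_
    rw [← hbdry, intervalIntegral.integral_of_le (by norm_num), ← integral_indicator
      measurableSet_Ioc]
    refine integral_congr_ae (Eventually.of_forall fun t => ?_)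
    by_cases ht : t ∈ Set.Ioc (-1 : ℝ) 1
    · simp only [Set.indicator_of_mem ht, Circle.smul_def, Real.fourierChar_apply, smul_eq_mul]
      have : (((2 * Real.pi * -(t * -(x / (2 * Real.pi))) : ℝ)) : ℂ) * Complex.I =
          t * x * Complex.I := by
        have : (Real.pi : ℂ) ≠ 0 := by simp [Real.pi_ne_zero]
        push_cast
        field_simp
      rw [this]
      ring
    · simp [Set.indicator_of_notMem ht]
  simpa [Function.comp_def] using (Complex.continuous_re.tendsto 0).comp hlim

/-- If the Fejér averages of a bounded function tend to `0` at every scale, then the function cannot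
stay above a positive level on arbitrarily late intervals of fixed length: at a fine enough scale
the kernel centred at the interval has almost all of its mass over it. -/
lemma eventually_not_forall_le_of_tendsto_fejer {B : ℝ → ℝ} {C : ℝ} (hBm : Measurable B)
    (hB : ∀ u, |B u| ≤ C)
    (hlim : ∀ l > 0, Tendsto (fun x : ℝ => ∫ y : ℝ, B ((x - y) / l) * Real.sinc (y / 2) ^ 2)
      atTop (𝓝 0)) {δ η : ℝ} (hδ : 0 < δ) (hη : 0 < η) :
    ∀ᶠ a in atTop, ¬ ∀ u ∈ Set.Icc a (a + δ), η ≤ B u := by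
  set m := ∫ y : ℝ, Real.sinc (y / 2) ^ 2 with hm
  have hm0 : 0 < m := integral_sinc_half_sq_pos
  have hI : Tendsto (fun R : ℝ => (η + C) * (∫ y in -R..R, Real.sinc (y / 2) ^ 2) - C * m) atTop
      (𝓝 ((η + C) * m - C * m)) :=
    ((intervalIntegral_tendsto_integral integrable_sinc_half_sq tendsto_neg_atTop_atBot
      tendsto_id).const_mul _).sub_const _
  have hlt : η * m / 2 < (η + C) * m - C * m := by nlinarith [mul_pos hη hm0]
  obtain ⟨R, hR, hR0⟩ := ((hI.eventually_const_lt hlt).and (eventually_gt_atTop 0)).exists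
  -- at this scale the window `[-R, R]` of the kernel covers exactly the interval of length `δ`
  obtain ⟨l, hl⟩ : ∃ l, l = 2 * R / δ := ⟨_, rfl⟩
  have hl0 : 0 < l := by rw [hl]; positivity
  have hx : Tendsto (fun a : ℝ => l * (a + δ / 2)) atTop atTop :=
    (tendsto_atTop_add_const_right _ _ tendsto_id).const_mul_atTop hl0
  have hsm := ((hlim l hl0).comp hx).eventually_lt_const (show 0 < η * m / 2 by positivity)
  filter_upwards [hsm] with a ha hall
  simp only [Function.comp] at ha
  have hC : 0 ≤ C := (abs_nonneg _).trans (hB 0)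
  have hBi : Integrable fun y : ℝ => B ((l * (a + δ / 2) - y) / l) * Real.sinc (y / 2) ^ 2 := by
    refine (integrable_sinc_half_sq.const_mul C).mono'
      (Measurable.aestronglyMeasurable (by fun_prop)) (Eventually.of_forall fun y => ?_)
    rw [norm_mul, Real.norm_of_nonneg (sq_nonneg _)]
    gcongr
    exact hB _
  have hind : Integrable fun y : ℝ =>
      (η + C) * (Set.Ioc (-R) R).indicator (fun y => Real.sinc (y / 2) ^ 2) y -
        C * Real.sinc (y / 2) ^ 2 :=
    ((integrable_sinc_half_sq.indicator measurableSet_Ioc).const_mul _).sub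
      (integrable_sinc_half_sq.const_mul C)
  -- `B ≥ η` on the window and `B ≥ -C` elsewhere
  have key := integral_mono hind hBi fun y => ?_
  · rw [integral_sub ((integrable_sinc_half_sq.indicator measurableSet_Ioc).const_mul _)
      (integrable_sinc_half_sq.const_mul C), integral_const_mul, integral_const_mul,
      integral_indicator measurableSet_Ioc, ← intervalIntegral.integral_of_le (by linarith)] at key
    linarith
  · have hK := sq_nonneg (Real.sinc (y / 2))
    have hlow := (abs_le.mp (hB ((l * (a + δ / 2) - y) / l))).1
    by_cases hy : y ∈ Set.Ioc (-R) R
    · have : η ≤ B ((l * (a + δ / 2) - y) / l) := by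
        have e : (l * (a + δ / 2) - y) / l = a + δ / 2 - y / l := by field_simp
        have e2 : R / l = δ / 2 := by rw [hl]; field_simp
        have e3 : y / l ≤ R / l := by gcongr; exact hy.2
        have e4 : -(R / l) ≤ y / l := by rw [← neg_div]; gcongr; exact hy.1.le
        refine hall _ ?_
        rw [e]
        constructor <;> linarith
      simp only [Set.indicator_of_mem hy]
      nlinarith
    · simp only [Set.indicator_of_notMem hy]
      nlinarith

/-- A Wiener–Ikehara theorem for bounded functions: if `(1 + B(u)) e^u` is monotone, `B` is bounded
and its Laplace transform extends continuously to the closed right half-plane, then `B → 0`. -/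
theorem tendsto_zero_of_laplace_continuousOn {B : ℝ → ℝ} {C : ℝ} {g : ℂ → ℂ} (hBm : Measurable B)
    (hB : ∀ u, |B u| ≤ C) (hB0 : ∀ u < 0, B u = 0) (hg : ContinuousOn g {z | 0 ≤ z.re})
    (hL : ∀ z : ℂ, 0 < z.re → ∫ u in Set.Ioi (0 : ℝ), (B u : ℂ) * Complex.exp (-z * u) = g z)
    (hmono : ∀ u v, 0 ≤ u → u ≤ v → (1 + B u) * Real.exp u ≤ (1 + B v) * Real.exp v) :
    Tendsto B atTop (𝓝 0) := by
  -- rescaling `u` by `l` rescales the Laplace transform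
  have hlim : ∀ l > 0, Tendsto (fun x : ℝ => ∫ y : ℝ, B ((x - y) / l) * Real.sinc (y / 2) ^ 2)
      atTop (𝓝 0) := by
    intro l hl
    refine tendsto_integral_fejer_of_laplace (B := fun u => B (u / l)) (C := C)
      (g := fun z => l * g (l * z)) (by fun_prop) (fun u => hB _)
      (fun u hu => hB0 _ (div_neg_of_neg_of_pos hu hl)) ?_ ?_
    · refine continuousOn_const.mul (hg.comp (by fun_prop) fun z hz => ?_)
      have : 0 ≤ l * z.re := mul_nonneg hl.le hz
      simpa using this
    · intro z hz
      rw [← hL (l * z) (by simpa using mul_pos hl hz)]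
      have := integral_comp_mul_left_Ioi (fun u : ℝ => (B (u / l) : ℂ) * Complex.exp (-z * u)) 0 hl
      rw [mul_zero, eq_inv_smul_iff₀ hl.ne'] at this
      rw [← this, Complex.real_smul]
      congr 1
      refine integral_congr_ae (Eventually.of_forall fun u => ?_)
      simp only [mul_div_cancel_left₀ u hl.ne']
      congr 2
      push_cast
      ring
  have hlim' : ∀ l > 0, Tendsto (fun x : ℝ => ∫ y : ℝ, -B ((x - y) / l) * Real.sinc (y / 2) ^ 2)
      atTop (𝓝 0) := by
    intro l hl
    simpa [integral_neg] using (hlim l hl).neg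
  have hsq : ∀ η, 0 < η → η < 1 → (∀ᶠ u in atTop, B u < η) ∧ ∀ᶠ u in atTop, -η < B u := by
    intro η h0 h1
    constructor
    -- by monotonicity a value `≥ η` stays `≥ η / 2` for the time `log ((1 + η) / (1 + η / 2))`
    · have hq : 1 < (1 + η) / (1 + η / 2) := by rw [one_lt_div (by linarith)]; linarith
      filter_upwards [eventually_not_forall_le_of_tendsto_fejer hBm hB hlim (Real.log_pos hq)
        (half_pos h0), eventually_ge_atTop 0] with a ha ha0
      by_contra! hcon
      refine ha fun u hu => ?_
      have h2 := hmono a u ha0 hu.1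
      have h3 : Real.exp u ≤ Real.exp a * ((1 + η) / (1 + η / 2)) := by
        rw [← Real.exp_log (show 0 < (1 + η) / (1 + η / 2) by linarith), ← Real.exp_add]
        exact Real.exp_le_exp.mpr hu.2
      have h4 : (1 + η) * Real.exp a ≤ (1 + B u) * Real.exp u := by
        refine le_trans ?_ h2
        gcongr
      have h5 : 0 < 1 + B u := by
        by_contra! h
        have := mul_nonpos_of_nonpos_of_nonneg h (Real.exp_pos u).le
        have := mul_pos (show 0 < 1 + η by linarith) (Real.exp_pos a)
        linarith
      have h6 : (1 + η) * Real.exp a ≤ (1 + B u) * ((1 + η) / (1 + η / 2)) * Real.exp a := by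
        calc _ ≤ _ := h4
          _ ≤ (1 + B u) * (Real.exp a * ((1 + η) / (1 + η / 2))) := by gcongr
          _ = _ := by ring
      have h7 := le_of_mul_le_mul_right h6 (Real.exp_pos a)
      rw [mul_div_assoc', le_div_iff₀ (by linarith), mul_comm] at h7
      have h8 := le_of_mul_le_mul_right h7 (show 0 < 1 + η by linarith)
      linarith
    -- and before a value `≤ -η` the function is `≤ -η / 2`
    · have hq : 1 < (1 - η / 2) / (1 - η) := by rw [one_lt_div (by linarith)]; linarith
      have hev := (eventually_not_forall_le_of_tendsto_fejer hBm.neg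
        (fun u => by simpa using hB u) hlim' (Real.log_pos hq) (half_pos h0)).and
          (eventually_ge_atTop 0)
      filter_upwards [(tendsto_atTop_add_const_right _ (-Real.log ((1 - η / 2) / (1 - η)))
        tendsto_id).eventually hev] with v ⟨ha, ha0⟩
      simp only [id] at ha ha0
      by_contra! hcon
      refine ha fun u hu => ?_
      rw [neg_add_cancel_right] at hu
      have h2 := hmono u v (ha0.trans hu.1) hu.2
      have h3 : Real.exp v ≤ Real.exp u * ((1 - η / 2) / (1 - η)) := by
        rw [← Real.exp_log (show 0 < (1 - η / 2) / (1 - η) by linarith), ← Real.exp_add]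
        exact Real.exp_le_exp.mpr (by linarith [hu.1])
      have h4 : (1 + B u) * Real.exp u ≤ (1 - η / 2) * Real.exp u := by
        calc _ ≤ _ := h2
          _ ≤ (1 - η) * Real.exp v := by gcongr; linarith
          _ ≤ (1 - η) * (Real.exp u * ((1 - η / 2) / (1 - η))) := by gcongr
          _ = _ := by
            have : 1 - η ≠ 0 := by linarith
            field_simp
      have := le_of_mul_le_mul_right h4 (Real.exp_pos u)
      simp only [Pi.neg_apply]
      linarith
  rw [Metric.tendsto_nhds]
  intro ε hε
  obtain ⟨h1, h2⟩ := hsq (min ε (1 / 2)) (by positivity) (by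
    exact (min_le_right _ _).trans_lt (by norm_num))
  filter_upwards [h1, h2] with u hu1 hu2
  rw [Real.dist_eq, sub_zero, abs_lt]
  have := min_le_left ε (1 / 2)
  constructor <;> linarith

/-! ### The prime number theorem -/

/-- `∑ Λ(n) n⁻ˢ - 1 / (s - 1)` extends continuously to `Re s ≥ 1`; this is the nonvanishing of `ζ`
on the line `Re s = 1`. -/
lemma exists_continuousOn_LSeries_vonMangoldt : ∃ G : ℂ → ℂ, ContinuousOn G {s | 1 ≤ s.re} ∧
    ∀ s : ℂ, 1 < s.re →
      LSeries (fun n => (ArithmeticFunction.vonMangoldt n : ℂ)) s = 1 / (s - 1) + G s := by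
  refine ⟨_, ArithmeticFunction.vonMangoldt.continuousOn_LFunctionResidueClassAux (q := 1) 1,
    fun s hs => ?_⟩
  rw [ArithmeticFunction.vonMangoldt.eqOn_LFunctionResidueClassAux (q := 1) isUnit_one hs]
  have : ∀ n : ℕ, ArithmeticFunction.vonMangoldt.residueClass (1 : ZMod 1) n =
      ArithmeticFunction.vonMangoldt n := by
    intro n
    simp [ArithmeticFunction.vonMangoldt.residueClass, Subsingleton.elim (n : ZMod 1) 1]
  simp [this]

/-- The **prime number theorem**, for `ψ`. -/
theorem tendsto_psi_div_self : Tendsto (fun x : ℝ => Chebyshev.psi x / x) atTop (𝓝 1) := by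
  obtain ⟨G, hG, hGeq⟩ := exists_continuousOn_LSeries_vonMangoldt
  set B : ℝ → ℝ := Set.indicator (Set.Ici 0)
    (fun u => Chebyshev.psi (Real.exp u) * Real.exp (-u) - 1) with hBdef
  have hBpos : ∀ u, 0 ≤ u → B u = Chebyshev.psi (Real.exp u) * Real.exp (-u) - 1 := fun u hu =>
    Set.indicator_of_mem (by simpa using hu) _
  have hpsi : ∀ u, 0 ≤ Chebyshev.psi (Real.exp u) * Real.exp (-u) ∧
      Chebyshev.psi (Real.exp u) * Real.exp (-u) ≤ Real.log 4 + 4 := by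
    intro u
    refine ⟨mul_nonneg (Chebyshev.psi_nonneg _) (Real.exp_pos _).le, ?_⟩
    have := Chebyshev.psi_le_const_mul_self (Real.exp_pos u).le
    calc _ ≤ (Real.log 4 + 4) * Real.exp u * Real.exp (-u) := by gcongr
      _ = _ := by rw [mul_assoc, ← Real.exp_add]; simp
  have hl4 : 0 < Real.log 4 := Real.log_pos (by norm_num)
  have hBm : Measurable B := by
    refine Measurable.indicator ?_ measurableSet_Ici
    exact ((Chebyshev.psi_mono.measurable.comp Real.measurable_exp).mul (by fun_prop)).sub_const _
  have hB : ∀ u, |B u| ≤ Real.log 4 + 4 := by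
    intro u
    by_cases hu : 0 ≤ u
    · rw [hBpos u hu, abs_le]
      constructor <;> linarith [hpsi u]
    · rw [hBdef, Set.indicator_of_notMem (by simpa using hu), abs_zero]
      linarith
  have hlim : Tendsto B atTop (𝓝 0) := by
    -- with `s = 1 + z`, the transform of `B` is `(1 / (s - 1) + G(s)) / s - 1 / z = (G(s) - 1) / s`
    refine tendsto_zero_of_laplace_continuousOn (g := fun z => (G (1 + z) - 1) / (1 + z)) hBm hB
      (fun u hu => Set.indicator_of_notMem (by simpa using hu) _) ?_ ?_ ?_
    · refine ContinuousOn.div ((hG.comp (by fun_prop) fun z hz => ?_).sub continuousOn_const)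
        (by fun_prop) fun z hz h => ?_
      · have : 0 ≤ z.re := hz
        simpa using this
      · have h1 : 0 ≤ z.re := hz
        have := congrArg Complex.re h
        simp at this
        linarith
    · intro z hz
      have hs : 1 < (1 + z).re := by simpa using hz
      have hs0 : (1 + z) ≠ 0 := fun h => by rw [h] at hs; simp at hs; linarith
      have hz0 : z ≠ 0 := fun h => by simp [h] at hz
      have hO : (fun n : ℕ => ∑ k ∈ Finset.Icc 1 n, (ArithmeticFunction.vonMangoldt k)) =O[atTop]
          fun n => (n : ℝ) ^ (1 : ℝ) := by
        refine IsBigO.of_bound (Real.log 4 + 4) (Eventually.of_forall fun n => ?_)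
        have h := Chebyshev.psi_le_const_mul_self (Nat.cast_nonneg (α := ℝ) n)
        have h0 := Chebyshev.psi_nonneg (n : ℝ)
        rw [Chebyshev.psi, Nat.floor_natCast] at h h0
        rw [Real.rpow_one, ← Finset.Icc_add_one_left_eq_Ioc, zero_add] at *
        rw [Real.norm_of_nonneg h0, Real.norm_of_nonneg (Nat.cast_nonneg _)]
        exact h
      have hF := LSeries_eq_mul_integral_of_nonneg (fun n => ArithmeticFunction.vonMangoldt n)
        zero_le_one hs hO fun n => ArithmeticFunction.vonMangoldt_nonneg
      rw [hGeq _ hs] at hF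
      have hsum : ∀ t : ℝ, ∑ k ∈ Finset.Icc 1 ⌊t⌋₊, (ArithmeticFunction.vonMangoldt k : ℂ) =
          (Chebyshev.psi t : ℂ) := by
        intro t
        rw [Chebyshev.psi, ← Finset.Icc_add_one_left_eq_Ioc, zero_add]
        push_cast
        rfl
      simp_rw [hsum] at hF
      have hsub := integral_comp_exp_Ioi
        (fun t : ℝ => (Chebyshev.psi t : ℂ) * (t : ℂ) ^ (-(1 + z + 1))) 0
      rw [Real.exp_zero] at hsub
      rw [← hsub] at hF
      have hpt : ∀ u : ℝ, Real.exp u • ((Chebyshev.psi (Real.exp u) : ℂ) *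
          ((Real.exp u : ℝ) : ℂ) ^ (-(1 + z + 1))) =
          ((Chebyshev.psi (Real.exp u) * Real.exp (-u) : ℝ) : ℂ) * Complex.exp (-z * u) := by
        intro u
        rw [Complex.cpow_def_of_ne_zero (by simp), ← Complex.ofReal_log
          (Real.exp_pos u).le, Real.log_exp, Complex.real_smul, Complex.ofReal_mul,
          Complex.ofReal_exp, Complex.ofReal_exp]
        have : Complex.exp u * Complex.exp (u * -(1 + z + 1)) =
            Complex.exp ((-u : ℝ) : ℂ) * Complex.exp (-z * u) := by
          rw [← Complex.exp_add, ← Complex.exp_add]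
          congr 1
          push_cast
          ring
        linear_combination (Chebyshev.psi (Real.exp u) : ℂ) * this
      simp_rw [hpt] at hF
      have hexp := integral_exp_mul_complex_Ioi (a := -z) (by simpa using hz) 0
      have hint1 : IntegrableOn (fun u : ℝ => Complex.exp (-z * u)) (Set.Ioi 0) :=
        integrableOn_exp_mul_complex_Ioi (by simpa using hz) 0
      have hint2 : IntegrableOn (fun u : ℝ =>
          ((Chebyshev.psi (Real.exp u) * Real.exp (-u) : ℝ) : ℂ) * Complex.exp (-z * u))
          (Set.Ioi 0) := by
        refine Integrable.bdd_mul (c := Real.log 4 + 4) hint1 ?_ ?_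
        · exact (Complex.measurable_ofReal.comp ((Chebyshev.psi_mono.measurable.comp
            Real.measurable_exp).mul (by fun_prop))).aestronglyMeasurable
        · refine Eventually.of_forall fun u => ?_
          rw [Complex.norm_real, Real.norm_of_nonneg (hpsi u).1]
          exact (hpsi u).2
      have : ∫ u in Set.Ioi (0 : ℝ), (B u : ℂ) * Complex.exp (-z * u) =
          ∫ u in Set.Ioi (0 : ℝ), (((Chebyshev.psi (Real.exp u) * Real.exp (-u) : ℝ) : ℂ) *
            Complex.exp (-z * u) - Complex.exp (-z * u)) := by
        refine setIntegral_congr_fun measurableSet_Ioi fun u hu => ?_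
        simp only [hBpos u (le_of_lt hu)]
        push_cast
        ring
      rw [this, integral_sub hint2 hint1, hexp]
      have hF' := (div_eq_iff hs0).mpr (hF.trans (mul_comm _ _))
      rw [← hF']
      simp only [Complex.ofReal_zero, mul_zero, Complex.exp_zero, add_sub_cancel_left]
      field_simp
      ring
    · intro u v hu huv
      have h : ∀ w : ℝ, 0 ≤ w → (1 + B w) * Real.exp w = Chebyshev.psi (Real.exp w) := by
        intro w hw
        rw [hBpos w hw, add_sub_cancel, mul_assoc, ← Real.exp_add]
        simp
      rw [h u hu, h v (hu.trans huv)]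
      exact Chebyshev.psi_mono (Real.exp_le_exp.mpr huv)
  have := (hlim.comp Real.tendsto_log_atTop).const_add 1
  rw [add_zero] at this
  refine this.congr' ?_
  filter_upwards [eventually_ge_atTop 1] with x hx
  have hx0 : 0 < x := by linarith
  simp only [Function.comp]
  rw [hBpos _ (Real.log_nonneg hx), Real.exp_neg, Real.exp_log hx0, add_sub_cancel, div_eq_mul_inv]

lemma tendsto_theta_div_self : Tendsto (fun x : ℝ => Chebyshev.theta x / x) atTop (𝓝 1) := by
  have h0 : Tendsto (fun x : ℝ => 2 * Real.sqrt x * Real.log x / x) atTop (𝓝 0) := by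
    have := (isLittleO_log_rpow_atTop (r := 1 / 2) (by norm_num)).tendsto_div_nhds_zero.const_mul 2
    rw [mul_zero] at this
    refine this.congr' ?_
    filter_upwards [eventually_gt_atTop 0] with x hx
    rw [← Real.sqrt_eq_rpow]
    have h1 := Real.mul_self_sqrt hx.le
    have h2 := (Real.sqrt_pos.mpr hx).ne'
    rw [mul_div_assoc', div_eq_div_iff h2 hx.ne']
    linear_combination -2 * Real.log x * h1
  have h1 : Tendsto (fun x : ℝ => (Chebyshev.psi x - Chebyshev.theta x) / x) atTop (𝓝 0) := by
    refine squeeze_zero_norm' ?_ h0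
    filter_upwards [eventually_ge_atTop 1] with x hx
    have hx0 : 0 < x := by linarith
    rw [norm_div, Real.norm_of_nonneg hx0.le]
    gcongr
    exact Chebyshev.abs_psi_sub_theta_le_sqrt_mul_log hx
  have := tendsto_psi_div_self.sub h1
  rw [sub_zero] at this
  exact this.congr fun x => by rw [← sub_div, sub_sub_cancel]

/-! ### Karamata's Tauberian theorem -/

section Karamata

variable {ι : Type*} {w l : ι → ℝ} {α A : ℝ}

lemma summable_mul_exp_mul_of_continuousOn (hw : ∀ i, 0 ≤ w i) (hl : ∀ i, 0 ≤ l i)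
    (hs : ∀ δ > 0, Summable fun i => w i * Real.exp (-δ * l i)) {φ : ℝ → ℝ}
    (hφ : ContinuousOn φ (Set.Icc 0 1)) {δ : ℝ} (hδ : 0 < δ) :
    Summable fun i => w i * Real.exp (-δ * l i) * φ (Real.exp (-δ * l i)) := by
  obtain ⟨D, hD⟩ := isCompact_Icc.exists_bound_of_continuousOn hφ
  refine ((hs δ hδ).mul_right D).of_norm_bounded fun i => ?_
  have h0 : 0 ≤ w i * Real.exp (-δ * l i) := mul_nonneg (hw i) (Real.exp_pos _).le
  rw [norm_mul, Real.norm_of_nonneg h0]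
  gcongr
  exact hD _ ⟨(Real.exp_pos _).le, Real.exp_le_one_iff.mpr (by nlinarith [hl i])⟩

lemma integrableOn_rpow_mul_exp_mul_of_continuousOn (hα : 0 < α) {φ : ℝ → ℝ}
    (hφ : ContinuousOn φ (Set.Icc 0 1)) :
    IntegrableOn (fun v : ℝ => v ^ (α - 1) * Real.exp (-v) * φ (Real.exp (-v))) (Set.Ioi 0) := by
  obtain ⟨D, hD⟩ := isCompact_Icc.exists_bound_of_continuousOn hφ
  have hmem : ∀ v : ℝ, 0 < v → Real.exp (-v) ∈ Set.Icc (0 : ℝ) 1 := fun v hv =>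
    ⟨(Real.exp_pos _).le, Real.exp_le_one_iff.mpr (by linarith)⟩
  have hG := Real.GammaIntegral_convergent hα
  refine Integrable.mul_bdd (c := D) ?_ ?_ ?_
  · exact hG.congr (Eventually.of_forall fun v => mul_comm _ _)
  · exact (hφ.comp (by fun_prop) fun v hv => hmem v hv).aestronglyMeasurable measurableSet_Ioi
  · filter_upwards [ae_restrict_mem measurableSet_Ioi] with v hv using hD _ (hmem v hv)

/-- Karamata's principle: the weighted point masses at `e^{-δ l_i}` converge weakly, first against
monomials, where this is the hypothesis at `(k + 1) δ`, and then against every continuous function,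
by Weierstrass approximation. -/
lemma tendsto_rpow_mul_tsum_of_continuousOn (hα : 0 < α) (hw : ∀ i, 0 ≤ w i) (hl : ∀ i, 0 ≤ l i)
    (hs : ∀ δ > 0, Summable fun i => w i * Real.exp (-δ * l i))
    (hlim : Tendsto (fun δ : ℝ => δ ^ α * ∑' i, w i * Real.exp (-δ * l i)) (𝓝[>] 0) (𝓝 A))
    {φ : ℝ → ℝ} (hφ : ContinuousOn φ (Set.Icc 0 1)) :
    Tendsto (fun δ : ℝ => δ ^ α * ∑' i, w i * Real.exp (-δ * l i) * φ (Real.exp (-δ * l i)))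
      (𝓝[>] 0)
      (𝓝 (A / Real.Gamma α *
        ∫ v in Set.Ioi (0 : ℝ), v ^ (α - 1) * Real.exp (-v) * φ (Real.exp (-v)))) := by
  have hΓ := Real.Gamma_pos_of_pos hα
  have hA : 0 ≤ A := by
    refine ge_of_tendsto hlim ?_
    filter_upwards [self_mem_nhdsWithin] with δ (hδ : 0 < δ)
    exact mul_nonneg (Real.rpow_nonneg hδ.le _)
      (tsum_nonneg fun i => mul_nonneg (hw i) (Real.exp_pos _).le)
  have hpoly : ∀ P : Polynomial ℝ, Tendsto (fun δ : ℝ => δ ^ α *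
      ∑' i, w i * Real.exp (-δ * l i) * P.eval (Real.exp (-δ * l i))) (𝓝[>] 0)
      (𝓝 (A / Real.Gamma α *
        ∫ v in Set.Ioi (0 : ℝ), v ^ (α - 1) * Real.exp (-v) * P.eval (Real.exp (-v)))) := by
    intro P
    induction P using Polynomial.induction_on' with
    | add P Q hP hQ =>
      have hPQ := hP.add hQ
      rw [← mul_add, ← integral_add
        (integrableOn_rpow_mul_exp_mul_of_continuousOn hα P.continuous.continuousOn)
        (integrableOn_rpow_mul_exp_mul_of_continuousOn hα Q.continuous.continuousOn)] at hPQ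
      simp only [Polynomial.eval_add, mul_add]
      refine hPQ.congr' ?_
      filter_upwards [self_mem_nhdsWithin] with δ (hδ : 0 < δ)
      rw [← mul_add, (summable_mul_exp_mul_of_continuousOn hw hl hs P.continuous.continuousOn
        hδ).tsum_add (summable_mul_exp_mul_of_continuousOn hw hl hs Q.continuous.continuousOn hδ)]
    | monomial k a =>
      have hk : (0 : ℝ) < k + 1 := by positivity
      have hmul : Tendsto (fun δ : ℝ => ((k : ℝ) + 1) * δ) (𝓝[>] 0) (𝓝[>] 0) := by
        refine tendsto_nhdsWithin_iff.mpr ⟨?_, ?_⟩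
        · have : Continuous fun δ : ℝ => ((k : ℝ) + 1) * δ := by fun_prop
          simpa using (this.tendsto 0).mono_left nhdsWithin_le_nhds
        · filter_upwards [self_mem_nhdsWithin] with δ (hδ : 0 < δ)
          exact mul_pos hk hδ
      have h1 := (hlim.comp hmul).const_mul (a * ((k : ℝ) + 1) ^ (-α))
      have hval : A / Real.Gamma α * ∫ v in Set.Ioi (0 : ℝ),
          v ^ (α - 1) * Real.exp (-v) * (Polynomial.monomial k a).eval (Real.exp (-v)) =
          a * ((k : ℝ) + 1) ^ (-α) * A := by
        have : ∀ v : ℝ, v ^ (α - 1) * Real.exp (-v) *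
            (Polynomial.monomial k a).eval (Real.exp (-v)) =
            a * (v ^ (α - 1) * Real.exp (-((k + 1 : ℝ) * v))) := by
          intro v
          have : Real.exp (-((k + 1 : ℝ) * v)) = Real.exp (-v) * Real.exp (-v) ^ k := by
            rw [← Real.exp_nat_mul, ← Real.exp_add]
            congr 1
            ring
          rw [Polynomial.eval_monomial, this]
          ring
        simp_rw [this]
        rw [integral_const_mul, Real.integral_rpow_mul_exp_neg_mul_Ioi hα hk, one_div,
          Real.inv_rpow hk.le, Real.rpow_neg hk.le]
        field_simp
      rw [hval]
      refine h1.congr' ?_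
      filter_upwards [self_mem_nhdsWithin] with δ (hδ : 0 < δ)
      simp only [Function.comp]
      have : ∀ i, w i * Real.exp (-δ * l i) *
          (Polynomial.monomial k a).eval (Real.exp (-δ * l i)) =
          a * (w i * Real.exp (-((k + 1 : ℝ) * δ) * l i)) := by
        intro i
        have : Real.exp (-((k + 1 : ℝ) * δ) * l i) =
            Real.exp (-δ * l i) * Real.exp (-δ * l i) ^ k := by
          rw [← Real.exp_nat_mul, ← Real.exp_add]
          congr 1
          ring
        rw [Polynomial.eval_monomial, this]
        ring
      simp_rw [this]
      rw [tsum_mul_left, Real.mul_rpow hk.le hδ.le, Real.rpow_neg hk.le]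
      have := (Real.rpow_pos_of_pos hk α).ne'
      field_simp
  have hone : ∫ v in Set.Ioi (0 : ℝ), v ^ (α - 1) * Real.exp (-v) = Real.Gamma α := by
    rw [Real.Gamma_eq_integral hα]
    exact integral_congr_ae (Eventually.of_forall fun v => mul_comm _ _)
  have hintone : IntegrableOn (fun v : ℝ => v ^ (α - 1) * Real.exp (-v)) (Set.Ioi 0) :=
    (Real.GammaIntegral_convergent hα).congr (Eventually.of_forall fun v => mul_comm _ _)
  rw [Metric.tendsto_nhds]
  intro ε hε
  obtain ⟨κ, hκ⟩ : ∃ κ, κ = ε / (2 * A + 2) := ⟨_, rfl⟩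
  have hκ0 : 0 < κ := by rw [hκ]; positivity
  obtain ⟨P, hP⟩ := exists_polynomial_near_of_continuousOn 0 1 φ hφ κ hκ0
  have hmemδ : ∀ δ > 0, ∀ i, Real.exp (-δ * l i) ∈ Set.Icc (0 : ℝ) 1 := fun δ hδ i =>
    ⟨(Real.exp_pos _).le, Real.exp_le_one_iff.mpr (by nlinarith [hl i])⟩
  -- replacing `φ` by `P` changes either side by at most `κ` times its value at `1`
  have hM : |A / Real.Gamma α * (∫ v in Set.Ioi (0 : ℝ), v ^ (α - 1) * Real.exp (-v) *
      P.eval (Real.exp (-v))) - A / Real.Gamma α *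
      ∫ v in Set.Ioi (0 : ℝ), v ^ (α - 1) * Real.exp (-v) * φ (Real.exp (-v))| ≤ κ * A := by
    rw [← mul_sub, ← integral_sub
      (integrableOn_rpow_mul_exp_mul_of_continuousOn hα P.continuous.continuousOn)
      (integrableOn_rpow_mul_exp_mul_of_continuousOn hα hφ), abs_mul,
      abs_of_nonneg (div_nonneg hA hΓ.le)]
    have : |∫ v in Set.Ioi (0 : ℝ), (v ^ (α - 1) * Real.exp (-v) * P.eval (Real.exp (-v)) -
        v ^ (α - 1) * Real.exp (-v) * φ (Real.exp (-v)))| ≤ κ * Real.Gamma α := by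
      rw [← hone, ← integral_const_mul, ← Real.norm_eq_abs]
      refine norm_integral_le_of_norm_le (hintone.const_mul κ) ?_
      filter_upwards [ae_restrict_mem measurableSet_Ioi] with v (hv : 0 < v)
      rw [← mul_sub, norm_mul, Real.norm_of_nonneg (by positivity), mul_comm]
      gcongr
      exact (hP _ ⟨(Real.exp_pos _).le, Real.exp_le_one_iff.mpr (by linarith)⟩).le
    calc _ ≤ A / Real.Gamma α * (κ * Real.Gamma α) := by gcongr
      _ = κ * A := by field_simp
  have hE : ∀ δ > 0, |δ ^ α * (∑' i, w i * Real.exp (-δ * l i) * φ (Real.exp (-δ * l i))) -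
      δ ^ α * ∑' i, w i * Real.exp (-δ * l i) * P.eval (Real.exp (-δ * l i))| ≤
      κ * (δ ^ α * ∑' i, w i * Real.exp (-δ * l i)) := by
    intro δ hδ
    have hδα := Real.rpow_pos_of_pos hδ α
    rw [← mul_sub, ← (summable_mul_exp_mul_of_continuousOn hw hl hs hφ hδ).tsum_sub
      (summable_mul_exp_mul_of_continuousOn hw hl hs P.continuous.continuousOn hδ), abs_mul,
      abs_of_pos hδα, mul_left_comm, ← tsum_mul_left]
    gcongr
    rw [← Real.norm_eq_abs]
    refine tsum_of_norm_bounded ((hs δ hδ).mul_left κ).hasSum fun i => ?_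
    have h0 : 0 ≤ w i * Real.exp (-δ * l i) := mul_nonneg (hw i) (Real.exp_pos _).le
    rw [← mul_sub, norm_mul, Real.norm_of_nonneg h0, mul_comm, norm_sub_rev]
    gcongr
    exact (hP _ (hmemδ δ hδ i)).le
  have h1 := (Metric.tendsto_nhds.mp (hpoly P)) κ hκ0
  have h2 := hlim.eventually_lt_const (show A < A + 1 / 2 by linarith)
  filter_upwards [h1, h2, self_mem_nhdsWithin] with δ h1 h2 (hδ : 0 < δ)
  rw [Real.dist_eq] at h1 ⊢
  have h3 := hE δ hδ
  have h4 : κ * (δ ^ α * ∑' i, w i * Real.exp (-δ * l i)) ≤ κ * (A + 1 / 2) := by gcongr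
  have h5 : κ * (2 * A + 2) = ε := by rw [hκ]; field_simp
  have h6 := abs_sub_le (δ ^ α * (∑' i, w i * Real.exp (-δ * l i) * φ (Real.exp (-δ * l i))))
    (δ ^ α * ∑' i, w i * Real.exp (-δ * l i) * P.eval (Real.exp (-δ * l i)))
    (A / Real.Gamma α * ∫ v in Set.Ioi (0 : ℝ), v ^ (α - 1) * Real.exp (-v) * φ (Real.exp (-v)))
  have h7 := abs_sub_le
    (δ ^ α * ∑' i, w i * Real.exp (-δ * l i) * P.eval (Real.exp (-δ * l i)))
    (A / Real.Gamma α * (∫ v in Set.Ioi (0 : ℝ), v ^ (α - 1) * Real.exp (-v) *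
      P.eval (Real.exp (-v))))
    (A / Real.Gamma α * ∫ v in Set.Ioi (0 : ℝ), v ^ (α - 1) * Real.exp (-v) * φ (Real.exp (-v)))
  nlinarith

/-- The function `1` on `(-∞, 1]`, `0` on `[1 + η, ∞)`, and linear in between. -/
def ramp (η v : ℝ) : ℝ := max 0 (min 1 ((1 + η - v) / η))

lemma continuous_ramp (η : ℝ) : Continuous (ramp η) := by
  unfold ramp
  fun_prop

lemma ramp_nonneg (η v : ℝ) : 0 ≤ ramp η v := le_max_left _ _

lemma ramp_le_one (η v : ℝ) : ramp η v ≤ 1 := max_le zero_le_one (min_le_left _ _)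

lemma ramp_of_le_one {η v : ℝ} (hη : 0 < η) (hv : v ≤ 1) : ramp η v = 1 := by
  have : 1 ≤ (1 + η - v) / η := by rw [le_div_iff₀ hη]; linarith
  rw [ramp, min_eq_left this, max_eq_right zero_le_one]

lemma ramp_of_le {η v : ℝ} (hη : 0 < η) (hv : 1 + η ≤ v) : ramp η v = 0 := by
  have : (1 + η - v) / η ≤ 0 := div_nonpos_of_nonpos_of_nonneg (by linarith) hη.le
  rw [ramp, max_eq_left ((min_le_right _ _).trans this)]

/-- In terms of `x = e^{-v}`, `e^v ramp(v)` is a continuous function of `x` on `[0, 1]`. -/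
lemma exists_continuous_ramp {η : ℝ} (hη : 0 < η) : ∃ φ : ℝ → ℝ, Continuous φ ∧
    ∀ v, Real.exp (-v) * φ (Real.exp (-v)) = ramp η v := by
  -- truncating `x` from below changes nothing, as `ramp` vanishes there
  have hpos : ∀ x : ℝ, 0 < max x (Real.exp (-(1 + η))) := fun x =>
    lt_max_of_lt_right (Real.exp_pos _)
  refine ⟨fun x => ramp η (-Real.log (max x (Real.exp (-(1 + η))))) /
    max x (Real.exp (-(1 + η))), ?_, fun v => ?_⟩
  · refine Continuous.div ((continuous_ramp η).comp (Continuous.neg (Continuous.log (by fun_prop)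
      fun x => (hpos x).ne'))) (by fun_prop) fun x => (hpos x).ne'
  · rcases le_total v (1 + η) with h | h
    · have : max (Real.exp (-v)) (Real.exp (-(1 + η))) = Real.exp (-v) :=
        max_eq_left (Real.exp_le_exp.mpr (by linarith))
      simp only [this, Real.log_exp, neg_neg]
      field_simp
    · have : max (Real.exp (-v)) (Real.exp (-(1 + η))) = Real.exp (-(1 + η)) :=
        max_eq_right (Real.exp_le_exp.mpr (by linarith))
      simp only [this, Real.log_exp, neg_neg, ramp_of_le hη le_rfl, ramp_of_le hη h, zero_div,
        mul_zero]

lemma integral_Ioi_rpow_mul_ramp_mem (hα : 0 < α) {η : ℝ} (hη : 0 < η) :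
    ∫ v in Set.Ioi (0 : ℝ), v ^ (α - 1) * ramp η v ∈ Set.Icc (1 / α) ((1 + η) ^ α / α) := by
  have hval : ∀ b : ℝ, 0 ≤ b → ∫ v in Set.Ioc (0 : ℝ) b, v ^ (α - 1) = b ^ α / α := by
    intro b hb
    rw [← intervalIntegral.integral_of_le hb, integral_rpow (Or.inl (by linarith))]
    simp [Real.zero_rpow hα.ne']
  have hon : ∀ b : ℝ, 0 ≤ b → IntegrableOn (fun v : ℝ => v ^ (α - 1)) (Set.Ioc 0 b) := by
    intro b hb
    rw [← intervalIntegrable_iff_integrableOn_Ioc_of_le hb]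
    exact intervalIntegral.intervalIntegrable_rpow' (by linarith)
  have hcut : ∀ b : ℝ, 1 + η ≤ b → ∫ v in Set.Ioi (0 : ℝ), v ^ (α - 1) * ramp η v =
      ∫ v in Set.Ioc (0 : ℝ) b, v ^ (α - 1) * ramp η v := by
    intro b hb
    refine setIntegral_eq_of_subset_of_forall_sdiff_eq_zero measurableSet_Ioi
      Set.Ioc_subset_Ioi_self fun v hv => ?_
    have : b < v := by
      by_contra! h
      exact hv.2 ⟨hv.1, h⟩
    rw [ramp_of_le hη (by linarith), mul_zero]
  have hη1 : (0 : ℝ) ≤ 1 + η := by linarith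
  have hint : IntegrableOn (fun v : ℝ => v ^ (α - 1) * ramp η v) (Set.Ioc 0 (1 + η)) := by
    refine Integrable.mul_bdd (c := 1) (hon _ hη1) (continuous_ramp η).aestronglyMeasurable
      (Eventually.of_forall fun v => ?_)
    rw [Real.norm_of_nonneg (ramp_nonneg _ _)]
    exact ramp_le_one _ _
  rw [hcut _ le_rfl]
  constructor
  · have h1 : ∫ v in Set.Ioc (0 : ℝ) 1, v ^ (α - 1) * ramp η v = 1 / α := by
      rw [show 1 / α = 1 ^ α / α by simp, ← hval 1 zero_le_one]
      refine setIntegral_congr_fun measurableSet_Ioc fun v hv => ?_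
      simp only [ramp_of_le_one hη hv.2, mul_one]
    rw [← h1]
    refine setIntegral_mono_set hint ?_ (Set.Ioc_subset_Ioc_right (by linarith)).eventuallyLE
    filter_upwards [ae_restrict_mem measurableSet_Ioc] with v hv
    exact mul_nonneg (Real.rpow_nonneg hv.1.le _) (ramp_nonneg _ _)
  · rw [← hval _ hη1]
    refine setIntegral_mono_on hint (hon _ hη1) measurableSet_Ioc fun v hv => ?_
    exact mul_le_of_le_one_right (Real.rpow_nonneg hv.1.le _) (ramp_le_one _ _)

/-- The **Hardy–Littlewood–Karamata Tauberian theorem**, for general Dirichlet series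
`∑ w_i e^{-δ l_i}` with nonnegative coefficients. -/
theorem tendsto_tsum_ite_div_rpow_of_tendsto_rpow_mul_tsum (hα : 0 < α) (hw : ∀ i, 0 ≤ w i)
    (hl : ∀ i, 0 ≤ l i) (hs : ∀ δ > 0, Summable fun i => w i * Real.exp (-δ * l i))
    (hlim : Tendsto (fun δ : ℝ => δ ^ α * ∑' i, w i * Real.exp (-δ * l i)) (𝓝[>] 0) (𝓝 A)) :
    Tendsto (fun X : ℝ => (∑' i, if l i ≤ X then w i else 0) / X ^ α) atTop
      (𝓝 (A / Real.Gamma (α + 1))) := by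
  set F : ℝ → ℝ := fun X => ∑' i, if l i ≤ X then w i else 0 with hF
  set c := A / Real.Gamma (α + 1) with hc
  have hΓ := Real.Gamma_pos_of_pos hα
  have hA : 0 ≤ A := by
    refine ge_of_tendsto hlim ?_
    filter_upwards [self_mem_nhdsWithin] with δ (hδ : 0 < δ)
    exact mul_nonneg (Real.rpow_nonneg hδ.le _)
      (tsum_nonneg fun i => mul_nonneg (hw i) (Real.exp_pos _).le)
  have hcα : A / Real.Gamma α * (1 / α) = c := by
    rw [hc, Real.Gamma_add_one hα.ne']
    field_simp
  have hFs : ∀ X > 0, Summable fun i => if l i ≤ X then w i else 0 := by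
    intro X hX
    refine ((hs (1 / X) (by positivity)).mul_right (Real.exp 1)).of_nonneg_of_le
      (fun i => by split_ifs <;> simp [hw i]) fun i => ?_
    split_ifs with h
    · rw [mul_assoc, ← Real.exp_add]
      refine le_mul_of_one_le_right (hw i) (Real.one_le_exp ?_)
      have : l i / X ≤ 1 := by rwa [div_le_one hX]
      rw [show -(1 / X) * l i = -(l i / X) by ring]
      linarith
    · exact mul_nonneg (mul_nonneg (hw i) (Real.exp_pos _).le) (Real.exp_pos _).le
  -- replacing the sharp cutoff by `ramp η` gives sums to which the weak convergence applies
  have hsmooth : ∀ η > 0, ∃ cη ∈ Set.Icc c (c * (1 + η) ^ α),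
      Tendsto (fun X : ℝ => (∑' i, w i * ramp η (l i / X)) / X ^ α) atTop (𝓝 cη) ∧
      ∀ X > 0, F X ≤ ∑' i, w i * ramp η (l i / X) ∧
        ∑' i, w i * ramp η (l i / X) ≤ F ((1 + η) * X) := by
    intro η hη
    obtain ⟨φ, hφ, hφr⟩ := exists_continuous_ramp hη
    have ht := (tendsto_rpow_mul_tsum_of_continuousOn hα hw hl hs hlim
      hφ.continuousOn).comp tendsto_inv_atTop_nhdsGT_zero
    have hw' : ∀ X > 0, ∀ i, w i * Real.exp (-X⁻¹ * l i) * φ (Real.exp (-X⁻¹ * l i)) =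
        w i * ramp η (l i / X) := by
      intro X hX i
      rw [← hφr, mul_assoc, show -X⁻¹ * l i = -(l i / X) by ring]
    have hsr : ∀ X > 0, Summable fun i => w i * ramp η (l i / X) := by
      intro X hX
      refine (summable_mul_exp_mul_of_continuousOn hw hl hs hφ.continuousOn
        (inv_pos.mpr hX)).congr fun i => ?_
      rw [hw' X hX]
    simp_rw [mul_assoc _ (Real.exp _) (φ _), hφr] at ht
    obtain ⟨hm1, hm2⟩ := integral_Ioi_rpow_mul_ramp_mem hα hη
    refine ⟨_, ⟨?_, ?_⟩, ht.congr' ?_, fun X hX => ⟨?_, ?_⟩⟩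
    · rw [← hcα]
      gcongr
    · calc _ ≤ A / Real.Gamma α * ((1 + η) ^ α / α) := by gcongr
        _ = _ := by rw [← hcα]; ring
    · filter_upwards [eventually_gt_atTop 0] with X hX
      simp only [Function.comp]
      rw [Real.inv_rpow hX.le, ← div_eq_inv_mul]
      congr 1
      refine tsum_congr fun i => ?_
      rw [← hw' X hX, mul_assoc]
    · refine (hFs X hX).tsum_le_tsum (fun i => ?_) (hsr X hX)
      split_ifs with h
      · rw [ramp_of_le_one hη ((div_le_one hX).mpr h), mul_one]
      · exact mul_nonneg (hw i) (ramp_nonneg _ _)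
    · refine (hsr X hX).tsum_le_tsum (fun i => ?_) (hFs _ (by positivity))
      split_ifs with h
      · exact mul_le_of_le_one_right (hw i) (ramp_le_one _ _)
      · rw [ramp_of_le hη ((le_div_iff₀ hX).mpr (not_le.mp h).le), mul_zero]
  refine tendsto_order.mpr ⟨fun a ha => ?_, fun a ha => ?_⟩
  -- let `η → 0`: `F(Y)` is at least the smoothed sum at `Y / (1 + η)`
  · have hcont : ContinuousAt (fun η : ℝ => c / (1 + η) ^ α) 0 := by
      refine ContinuousAt.div continuousAt_const (ContinuousAt.rpow_const (by fun_prop)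
        (Or.inl (by norm_num))) (by simp)
    obtain ⟨η, hη1, hη⟩ := ((hcont.mono_left nhdsWithin_le_nhds).eventually_const_lt
      (show a < c / (1 + 0) ^ α by simpa using ha)
      |>.and (self_mem_nhdsWithin (s := Set.Ioi (0 : ℝ)))).exists
    have hη0 : 0 < η := hη
    obtain ⟨cη, ⟨hc1, -⟩, ht, hb⟩ := hsmooth η hη0
    have hpow : 0 < (1 + η) ^ α := Real.rpow_pos_of_pos (by linarith) _
    have hev := ht.eventually_const_lt (show a * (1 + η) ^ α < cη by
      rw [lt_div_iff₀ hpow] at hη1; linarith)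
    have hdiv : Tendsto (fun Y : ℝ => Y / (1 + η)) atTop atTop :=
      tendsto_id.atTop_div_const (by linarith)
    filter_upwards [hdiv.eventually hev, eventually_gt_atTop 0] with Y hY hY0
    have hX : 0 < Y / (1 + η) := by positivity
    have h2 := (hb _ hX).2
    rw [mul_div_cancel₀ Y (by linarith : (1 + η) ≠ 0)] at h2
    rw [Real.div_rpow hY0.le (by linarith), lt_div_iff₀ (by positivity)] at hY
    rw [lt_div_iff₀ (by positivity)]
    calc a * Y ^ α = a * (1 + η) ^ α * (Y ^ α / (1 + η) ^ α) := by field_simp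
      _ < _ := hY
      _ ≤ F Y := h2
  -- and `F(X)` is at most the smoothed sum at `X`
  · have hcont : ContinuousAt (fun η : ℝ => c * (1 + η) ^ α) 0 := by
      refine ContinuousAt.mul continuousAt_const (ContinuousAt.rpow_const (by fun_prop)
        (Or.inl (by norm_num)))
    obtain ⟨η, hη1, hη⟩ := ((hcont.mono_left nhdsWithin_le_nhds).eventually_lt_const
      (show c * (1 + 0) ^ α < a by simpa using ha)
      |>.and (self_mem_nhdsWithin (s := Set.Ioi (0 : ℝ)))).exists
    obtain ⟨cη, ⟨-, hc2⟩, ht, hb⟩ := hsmooth η hη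
    filter_upwards [ht.eventually_lt_const (hc2.trans_lt hη1), eventually_gt_atTop 0] with X hX hX0
    refine lt_of_le_of_lt ?_ hX
    exact div_le_div_of_nonneg_right (hb X hX0).1 (by positivity)

end Karamata

/-! ### Euler products and meromorphic continuation -/

lemma omegaCoeff_nonneg (n : ℕ) : 0 ≤ omegaCoeff n := by
  unfold omegaCoeff
  positivity

lemma omegaCoeff_le_one (n : ℕ) : omegaCoeff n ≤ 1 :=
  pow_le_one₀ (by norm_num) (by norm_num)

lemma omegaCoeff_one : omegaCoeff 1 = 1 := by simp [omegaCoeff]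

lemma omegaCoeff_mul {m n : ℕ} (hm : m ≠ 0) (hn : n ≠ 0) :
    omegaCoeff (m * n) = omegaCoeff m * omegaCoeff n := by
  rw [omegaCoeff, ArithmeticFunction.cardFactors_mul hm hn, pow_add]
  rfl

lemma omegaCoeff_prime {p : ℕ} (hp : p.Prime) : omegaCoeff p = 2 / 3 := by
  rw [omegaCoeff, ArithmeticFunction.cardFactors_apply_prime hp, pow_one]

lemma abscissaOfAbsConv_omegaCoeff_le :
    LSeries.abscissaOfAbsConv (fun n => (omegaCoeff n : ℂ)) ≤ 1 := by
  refine LSeries.abscissaOfAbsConv_le_of_le_const ⟨1, fun n _ => ?_⟩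
  rw [Complex.norm_real, Real.norm_of_nonneg (omegaCoeff_nonneg n)]
  exact omegaCoeff_le_one n

lemma LSeriesSummable_omegaCoeff {s : ℂ} (hs : 1 < s.re) :
    LSeriesSummable (fun n => (omegaCoeff n : ℂ)) s :=
  LSeriesSummable_of_abscissaOfAbsConv_lt_re
    (abscissaOfAbsConv_omegaCoeff_le.trans_lt (by exact_mod_cast hs))

lemma differentiableOn_omegaL : DifferentiableOn ℂ omegaL {s : ℂ | 1 < s.re} :=
  (LSeries_differentiableOn _).mono fun s hs =>
    abscissaOfAbsConv_omegaCoeff_le.trans_lt (by exact_mod_cast (show 1 < s.re from hs))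

/-- The completely multiplicative function `n ↦ (2/3)^Ω(n) n⁻ˢ`, with value `0` at `n = 0`. -/
def omegaSummandHom {s : ℂ} (hs : s ≠ 0) : ℕ →*₀ ℂ where
  toFun n := omegaCoeff n * riemannZetaSummandHom hs n
  map_zero' := by simp
  map_one' := by simp [omegaCoeff_one]
  map_mul' m n := by
    rcases eq_or_ne m 0 with rfl | hm
    · simp
    rcases eq_or_ne n 0 with rfl | hn
    · simp
    rw [omegaCoeff_mul hm hn, map_mul]
    push_cast
    ring

lemma hasProd_omegaL {s : ℂ} (hs : 1 < s.re) :
    HasProd (fun p : Nat.Primes => (1 - 2 / 3 * ((p : ℕ) : ℂ) ^ (-s))⁻¹) (omegaL s) := by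
  have hs0 : s ≠ 0 := fun h => by simp [h] at hs; linarith
  have hterm : ∀ n, omegaSummandHom hs0 n = LSeries.term (fun n => (omegaCoeff n : ℂ)) s n := by
    intro n
    rcases eq_or_ne n 0 with rfl | hn
    · simp
    · rw [LSeries.term_of_ne_zero hn, div_eq_mul_inv, ← Complex.cpow_neg]
      rfl
  have h := EulerProduct.eulerProduct_completely_multiplicative_hasProd
    (f := omegaSummandHom hs0) (by simpa only [hterm] using (LSeriesSummable_omegaCoeff hs).norm)
  have e : ∑' n, omegaSummandHom hs0 n = omegaL s := tsum_congr hterm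
  rw [e] at h
  have e2 : ∀ p : Nat.Primes, omegaSummandHom hs0 p = 2 / 3 * ((p : ℕ) : ℂ) ^ (-s) := by
    intro p
    change (omegaCoeff p : ℂ) * ((p : ℕ) : ℂ) ^ (-s) = _
    rw [omegaCoeff_prime p.2]
    norm_num
  simpa only [e2] using h

/-- The local factor `(1 - x)² / (1 - (2/3) x)³` of `L³ / ζ²` at `x = p⁻ˢ`. -/
def correctionFactor (x : ℂ) : ℂ := (1 - x) ^ 2 * ((1 - 2 / 3 * x)⁻¹) ^ 3

lemma one_sub_two_thirds_mul_ne_zero {x : ℂ} (hx : ‖x‖ ≤ 1) : 1 - 2 / 3 * x ≠ 0 := by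
  intro h
  have h1 : ‖2 / 3 * x‖ = 1 := by rw [← sub_eq_zero.mp h, norm_one]
  rw [norm_mul] at h1
  norm_num at h1
  linarith

/-- The linear terms of `(1 - x)²` and `(1 - (2/3) x)³` agree. -/
lemma norm_correctionFactor_sub_one_le {x : ℂ} (hx : ‖x‖ ≤ 1) :
    ‖correctionFactor x - 1‖ ≤ 27 * ‖x‖ ^ 2 := by
  have hne := one_sub_two_thirds_mul_ne_zero hx
  have h3 : (1 / 3 : ℝ) ≤ ‖1 - 2 / 3 * x‖ := by
    have := norm_sub_norm_le (1 : ℂ) (2 / 3 * x)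
    rw [norm_mul] at this
    norm_num at this
    linarith
  have e : correctionFactor x - 1 = x ^ 2 * (-1 / 3 + 8 / 27 * x) * ((1 - 2 / 3 * x)⁻¹) ^ 3 := by
    have hinv : (1 - 2 / 3 * x) ^ 3 * ((1 - 2 / 3 * x)⁻¹) ^ 3 = 1 := by
      rw [← mul_pow, mul_inv_cancel₀ hne, one_pow]
    rw [correctionFactor]
    linear_combination hinv
  have h1 : ‖(-1 / 3 + 8 / 27 * x : ℂ)‖ ≤ 1 := by
    refine (norm_add_le _ _).trans ?_
    rw [norm_mul]
    norm_num
    linarith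
  have h4 : ‖1 - 2 / 3 * x‖⁻¹ ≤ 3 := by
    rw [inv_le_comm₀ (by linarith) (by norm_num)]
    linarith
  rw [e, norm_mul, norm_mul, norm_pow, norm_pow, norm_inv]
  calc _ ≤ ‖x‖ ^ 2 * 1 * 3 ^ 3 := by gcongr
    _ = _ := by ring

lemma norm_natCast_cpow_neg_le {σ : ℝ} {s : ℂ} (hs : σ ≤ s.re) (p : Nat.Primes) :
    ‖((p : ℕ) : ℂ) ^ (-s)‖ ≤ ((p : ℕ) : ℝ) ^ (-σ) := by
  rw [Complex.norm_natCast_cpow_of_pos p.2.pos]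
  exact Real.rpow_le_rpow_of_exponent_le (by exact_mod_cast p.2.one_lt.le) (by simpa using hs)

lemma norm_correctionFactor_cpow_sub_one_le {σ : ℝ} (hσ : 0 ≤ σ) {s : ℂ} (hs : σ ≤ s.re)
    (p : Nat.Primes) :
    ‖correctionFactor (((p : ℕ) : ℂ) ^ (-s)) - 1‖ ≤ 27 * ((p : ℕ) : ℝ) ^ (-(2 * σ)) := by
  have h := norm_natCast_cpow_neg_le hs p
  have h1 : ((p : ℕ) : ℝ) ^ (-σ) ≤ 1 :=
    Real.rpow_le_one_of_one_le_of_nonpos (by exact_mod_cast p.2.one_lt.le) (by linarith)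
  refine (norm_correctionFactor_sub_one_le (h.trans h1)).trans ?_
  have : ((p : ℕ) : ℝ) ^ (-(2 * σ)) = (((p : ℕ) : ℝ) ^ (-σ)) ^ 2 := by
    rw [← Real.rpow_natCast, ← Real.rpow_mul (Nat.cast_nonneg _)]
    congr 1
    push_cast
    ring
  rw [this]
  gcongr

/-- The Euler product `H = L³ / ζ²`, which converges on `Re s > 1/2`. -/
def correctionProd (s : ℂ) : ℂ := ∏' p : Nat.Primes, correctionFactor (((p : ℕ) : ℂ) ^ (-s))

lemma hasProd_correctionProd {s : ℂ} (hs : 1 / 2 < s.re) :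
    HasProd (fun p : Nat.Primes => correctionFactor (((p : ℕ) : ℂ) ^ (-s))) (correctionProd s) := by
  refine Multipliable.hasProd ?_
  have : Summable fun p : Nat.Primes => ‖correctionFactor (((p : ℕ) : ℂ) ^ (-s)) - 1‖ :=
    ((Nat.Primes.summable_rpow (r := -(2 * s.re)).mpr (by linarith)).mul_left 27).of_nonneg_of_le
      (fun _ => norm_nonneg _)
      fun p => norm_correctionFactor_cpow_sub_one_le (by linarith) le_rfl p
  simpa using multipliable_one_add_of_summable this

lemma differentiableOn_correctionProd :
    DifferentiableOn ℂ correctionProd {s : ℂ | 1 / 2 < s.re} := by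
  intro s hs
  -- the bounds are uniform only on smaller half-planes `Re z > σ`
  obtain ⟨σ, hσ, hσs⟩ := exists_between (show 1 / 2 < s.re from hs)
  have hopen : IsOpen {z : ℂ | σ < z.re} := isOpen_lt continuous_const Complex.continuous_re
  have hd : ∀ p : Nat.Primes, DifferentiableOn ℂ
      (fun z : ℂ => correctionFactor (((p : ℕ) : ℂ) ^ (-z)) - 1) {z : ℂ | σ < z.re} := by
    intro p z hz
    have h1 : DifferentiableAt ℂ (fun z : ℂ => ((p : ℕ) : ℂ) ^ (-z)) z :=
      (differentiableAt_id.neg).const_cpow (Or.inl (by exact_mod_cast p.2.ne_zero))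
    have h2 : 1 - 2 / 3 * ((p : ℕ) : ℂ) ^ (-z) ≠ 0 :=
      one_sub_two_thirds_mul_ne_zero ((norm_natCast_cpow_neg_le (le_of_lt hz) p).trans
        (Real.rpow_le_one_of_one_le_of_nonpos (by exact_mod_cast p.2.one_lt.le) (by linarith)))
    unfold correctionFactor
    exact ((((h1.const_sub 1).pow 2).mul ((((h1.const_mul _).const_sub 1).inv h2).pow 3)).sub_const
      1).differentiableWithinAt
  have hprod := ((Nat.Primes.summable_rpow (r := -(2 * σ)).mpr
    (by linarith)).mul_left 27).hasProdLocallyUniformlyOn_one_add hopen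
    (f := fun (p : Nat.Primes) (z : ℂ) => correctionFactor (((p : ℕ) : ℂ) ^ (-z)) - 1)
    (Eventually.of_forall fun p z hz =>
      norm_correctionFactor_cpow_sub_one_le (by linarith) (le_of_lt hz) p)
    fun p => (hd p).continuousOn
  have hdiff := hprod.differentiableOn (Eventually.of_forall fun S => by
    simpa [Finset.prod_fn] using
      DifferentiableOn.finsetProd fun p _ => (hd p).const_add 1) hopen
  have := (hdiff s hσs).differentiableAt (hopen.mem_nhds hσs)
  simp only [add_sub_cancel] at this
  exact this.differentiableWithinAt

lemma omegaL_pow_three {s : ℂ} (hs : 1 < s.re) :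
    omegaL s ^ 3 = riemannZeta s ^ 2 * correctionProd s := by
  have h1 := (hasProd_omegaL hs).pow 3
  have h2 := ((riemannZeta_eulerProduct_hasProd hs).pow 2).mul
    (hasProd_correctionProd (s := s) (by linarith))
  refine h1.unique ?_
  convert h2 using 2 with p
  have hne : 1 - ((p : ℕ) : ℂ) ^ (-s) ≠ 0 := by
    intro h
    have hlt : ‖((p : ℕ) : ℂ) ^ (-s)‖ < 1 := by
      rw [Complex.norm_natCast_cpow_of_pos p.2.pos]
      exact Real.rpow_lt_one_of_one_lt_of_neg (by exact_mod_cast p.2.one_lt)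
        (by rw [Complex.neg_re]; linarith)
    rw [← sub_eq_zero.mp h, norm_one] at hlt
    exact lt_irrefl _ hlt
  have hinv : (1 - ((p : ℕ) : ℂ) ^ (-s))⁻¹ ^ 2 * (1 - ((p : ℕ) : ℂ) ^ (-s)) ^ 2 = 1 := by
    rw [← mul_pow, inv_mul_cancel₀ hne, one_pow]
  rw [correctionFactor, ← mul_assoc, hinv, one_mul]

lemma eulerFactor_eq (p : Nat.Primes) : eulerFactor p =
    (1 + ((p : ℕ) : ℝ)⁻¹) ^ 2 * (1 - 2 / 3 * ((p : ℕ) : ℝ)⁻¹) ^ 3 := by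
  rw [eulerFactor]
  ring

lemma eulerFactor_pos (p : Nat.Primes) : 0 < eulerFactor p := by
  rw [eulerFactor_eq]
  have h1 : ((p : ℕ) : ℝ)⁻¹ ≤ 1 := inv_le_one_of_one_le₀ (by exact_mod_cast p.2.one_lt.le)
  have h0 : 0 < ((p : ℕ) : ℝ)⁻¹ := inv_pos.mpr (by exact_mod_cast p.2.pos)
  have : 0 < 1 - 2 / 3 * ((p : ℕ) : ℝ)⁻¹ := by linarith
  positivity

lemma summable_norm_eulerFactor_sub_one : Summable fun p => ‖eulerFactor p - 1‖ := by
  refine ((Nat.Primes.summable_rpow (r := -2).mpr (by norm_num)).mul_left 4).of_nonneg_of_le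
      (fun _ => norm_nonneg _) fun p => ?_
  have h1 : ((p : ℕ) : ℝ)⁻¹ ≤ 1 := inv_le_one_of_one_le₀ (by exact_mod_cast p.2.one_lt.le)
  have h0 : 0 < ((p : ℕ) : ℝ)⁻¹ := inv_pos.mpr (by exact_mod_cast p.2.pos)
  have e : ((p : ℕ) : ℝ) ^ (-2 : ℝ) = ((p : ℕ) : ℝ)⁻¹ ^ 2 := by
    rw [Real.rpow_neg (Nat.cast_nonneg _), inv_pow]
    norm_cast
  rw [e, eulerFactor]
  generalize ((p : ℕ) : ℝ)⁻¹ = x at *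
  have : 1 - 5 / 3 * x ^ 2 + 10 / 27 * x ^ 3 + 20 / 27 * x ^ 4 - 8 / 27 * x ^ 5 - 1 =
      x ^ 2 * (-5 / 3 + 10 / 27 * x + 20 / 27 * x ^ 2 - 8 / 27 * x ^ 3) := by ring
  rw [this, norm_mul, Real.norm_of_nonneg (sq_nonneg x), mul_comm]
  gcongr
  have h2 : x ^ 2 ≤ 1 := pow_le_one₀ h0.le h1
  have h3 : x ^ 3 ≤ 1 := pow_le_one₀ h0.le h1
  rw [Real.norm_eq_abs, abs_le]
  constructor <;> nlinarith [pow_pos h0 2, pow_pos h0 3]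

lemma multipliable_eulerFactor : Multipliable eulerFactor := by
  simpa using multipliable_one_add_of_summable summable_norm_eulerFactor_sub_one

lemma tprod_eulerFactor_pos : 0 < ∏' p : Nat.Primes, eulerFactor p := by
  refine lt_of_le_of_ne ?_ (Ne.symm ?_)
  · exact ge_of_tendsto' multipliable_eulerFactor.hasProd fun S =>
      Finset.prod_nonneg fun p _ => (eulerFactor_pos p).le
  · simpa using tprod_one_add_ne_zero_of_summable (f := fun p => eulerFactor p - 1)
      (fun p => by simpa using (eulerFactor_pos p).ne') summable_norm_eulerFactor_sub_one

/-- At `s = 1` the local factors of `H`, `ζ(2)²` and `P` multiply to `1`, since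
`1 - x² = (1 - x)(1 + x)`. -/
lemma correctionProd_one_mul :
    correctionProd 1 * (riemannZeta 2 ^ 2 * ((∏' p : Nat.Primes, eulerFactor p : ℝ) : ℂ)) = 1 := by
  have hP : HasProd (fun p : Nat.Primes => ((eulerFactor p : ℝ) : ℂ))
      ((∏' p : Nat.Primes, eulerFactor p : ℝ) : ℂ) :=
    multipliable_eulerFactor.hasProd.map Complex.ofRealHom Complex.continuous_ofReal
  have h := (hasProd_correctionProd (s := 1) (by norm_num)).mul
    (((riemannZeta_eulerProduct_hasProd (s := 2) (by norm_num)).pow 2).mul hP)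
  refine h.unique ?_
  convert hasProd_one with p
  have hx : ‖(((p : ℕ) : ℂ))⁻¹‖ < 1 := by
    rw [norm_inv, Complex.norm_natCast]
    exact inv_lt_one_of_one_lt₀ (by exact_mod_cast p.2.one_lt)
  have e2 : ((p : ℕ) : ℂ) ^ (-2 : ℂ) = (((p : ℕ) : ℂ))⁻¹ ^ 2 := by
    rw [Complex.cpow_neg, inv_pow]
    norm_cast
  rw [eulerFactor_eq, e2, Complex.cpow_neg, Complex.cpow_one, correctionFactor]
  push_cast
  generalize (((p : ℕ) : ℂ))⁻¹ = x at *
  have h1 := one_sub_two_thirds_mul_ne_zero hx.le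
  have h2 : 1 - x ≠ 0 := fun h => by
    rw [← sub_eq_zero.mp h] at hx; simp at hx
  have h3 : 1 + x ≠ 0 := fun h => by
    rw [← neg_eq_of_add_eq_zero_right h] at hx; simp at hx
  have h4 : 3 - x * 2 ≠ 0 := fun h => h1 (by linear_combination h / 3)
  rw [show 1 - x ^ 2 = (1 - x) * (1 + x) by ring]
  field_simp

lemma riemannZeta_two_eq_ofReal_re : riemannZeta 2 = ((riemannZeta 2).re : ℂ) := by
  rw [riemannZeta_two]
  norm_cast

lemma constA_pos : 0 < constA := by
  have h := riemannZeta_ne_zero_of_one_lt_re (s := 2) (by norm_num)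
  have hz : (riemannZeta 2).re ≠ 0 := fun h0 => h (by
    rw [riemannZeta_two_eq_ofReal_re, h0, Complex.ofReal_zero])
  have := tprod_eulerFactor_pos
  unfold constA
  positivity

lemma correctionProd_one : correctionProd 1 = (constA : ℂ) ^ 3 := by
  have hP := tprod_eulerFactor_pos
  have h3 : constA ^ 3 = ((riemannZeta 2).re ^ 2 * ∏' p : Nat.Primes, eulerFactor p)⁻¹ := by
    rw [constA, ← Real.rpow_natCast, ← Real.rpow_mul (by positivity), ← Real.rpow_neg_one]
    norm_num
  rw [eq_inv_of_mul_eq_one_left correctionProd_one_mul, ← Complex.ofReal_pow, h3,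
    riemannZeta_two_eq_ofReal_re]
  push_cast
  simp

/-- The meromorphic continuation of `L³` to `Re s > 1/2`, namely `ζ² H`. -/
lemma exists_meromorphic_continuation : ∃ M : ℂ → ℂ,
    (∀ s : ℂ, 1 < s.re → M s = omegaL s ^ 3) ∧
    MeromorphicOn M {s : ℂ | 1 / 2 < s.re} ∧
    DifferentiableOn ℂ M ({s : ℂ | 1 / 2 < s.re} \ {1}) ∧
    meromorphicOrderAt M 1 = ((-2 : ℤ) : WithTop ℤ) ∧
    Tendsto (fun s : ℂ => M s * (s - 1) ^ 2) (𝓝[≠] 1) (𝓝 ((constA : ℂ) ^ 3)) := by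
  have hopen : IsOpen {s : ℂ | 1 / 2 < s.re} := isOpen_lt continuous_const Complex.continuous_re
  -- `riemannZeta₁` is the entire function `(s - 1) ζ(s)`, with value `1` at `s = 1`
  set g : ℂ → ℂ := fun s => riemannZeta₁ s ^ 2 * correctionProd s with hg
  have hgd : DifferentiableOn ℂ g {s : ℂ | 1 / 2 < s.re} :=
    ((differentiable_riemannZeta₁.differentiableOn).pow 2).mul differentiableOn_correctionProd
  have hga : ∀ s : ℂ, 1 / 2 < s.re → AnalyticAt ℂ g s := fun s hs =>
    hgd.analyticAt (hopen.mem_nhds hs)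
  have h1 : (1 / 2 : ℝ) < (1 : ℂ).re := by norm_num
  have hg1 : g 1 = (constA : ℂ) ^ 3 := by
    rw [hg]
    simp only [riemannZeta₁_one, correctionProd_one, one_pow, one_mul]
  have hmer : MeromorphicOn (fun s => (s - 1) ^ (-2 : ℤ) * g s) {s : ℂ | 1 / 2 < s.re} := by
    intro s hs
    have : MeromorphicAt (fun s : ℂ => s - 1) s := by fun_prop
    exact (this.zpow _).mul (hga s hs).meromorphicAt
  refine ⟨fun s => (s - 1) ^ (-2 : ℤ) * g s, fun s hs => ?_, hmer, fun s hs => ?_, ?_, ?_⟩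
  · have hs1 : s ≠ 1 := fun h => by simp [h] at hs
    rw [omegaL_pow_three hs, riemannZeta_eq_inv_sub_mul hs1, mul_pow, inv_pow]
    simp only [hg]
    rw [zpow_neg, mul_assoc]
    norm_cast
  · have hs1 : s - 1 ≠ 0 := sub_ne_zero.mpr hs.2
    refine DifferentiableAt.differentiableWithinAt ?_
    refine DifferentiableAt.mul ?_ (hga s hs.1).differentiableAt
    exact DifferentiableAt.zpow (by fun_prop) (Or.inl hs1)
  · rw [meromorphicOrderAt_eq_int_iff (hmer 1 h1)]
    refine ⟨g, hga 1 h1, ?_, Eventually.of_forall fun z => rfl⟩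
    rw [hg1]
    exact pow_ne_zero _ (by exact_mod_cast constA_pos.ne')
  · have := (hga 1 h1).continuousAt.tendsto.mono_left (nhdsWithin_le_nhds (s := {1}ᶜ))
    rw [hg1] at this
    refine this.congr' ?_
    filter_upwards [self_mem_nhdsWithin] with s hs
    have hs1 : s - 1 ≠ 0 := sub_ne_zero.mpr hs
    rw [zpow_neg]
    field_simp

/-! ### The summatory function -/

lemma omegaCoeff_div_mul_exp_eq (δ : ℝ) (n : ℕ) :
    ((omegaCoeff n / n * Real.exp (-δ * Real.log n) : ℝ) : ℂ) =
      LSeries.term (fun n => (omegaCoeff n : ℂ)) (1 + δ : ℝ) n := by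
  rcases eq_or_ne n 0 with rfl | hn
  · simp
  have hn0 : (0 : ℝ) < n := by exact_mod_cast hn.bot_lt
  rw [LSeries.term_of_ne_zero hn, ← Complex.ofReal_natCast, ← Complex.ofReal_cpow hn0.le,
    ← Complex.ofReal_div, Real.rpow_add hn0, Real.rpow_one, neg_mul, Real.exp_neg, mul_comm δ,
    ← Real.rpow_def_of_pos hn0]
  congr 1
  field_simp

lemma summable_omegaCoeff_div_mul_exp {δ : ℝ} (hδ : 0 < δ) :
    Summable fun n : ℕ => omegaCoeff n / n * Real.exp (-δ * Real.log n) := by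
  rw [← Complex.summable_ofReal]
  simp_rw [omegaCoeff_div_mul_exp_eq]
  exact LSeriesSummable_omegaCoeff (by simpa using hδ)

/-- On the real axis `L > 0`, so the asymptotics of `L` follow from those of `L³`. -/
lemma tendsto_rpow_mul_tsum_omegaCoeff :
    Tendsto (fun δ : ℝ => δ ^ (2 / 3 : ℝ) *
      ∑' n : ℕ, omegaCoeff n / n * Real.exp (-δ * Real.log n)) (𝓝[>] 0) (𝓝 constA) := by
  obtain ⟨M, hM, -, -, -, hlim⟩ := exists_meromorphic_continuation
  have hone : Tendsto (fun δ : ℝ => ((1 + δ : ℝ) : ℂ)) (𝓝[>] 0) (𝓝[≠] 1) := by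
    refine tendsto_nhdsWithin_iff.mpr ⟨?_, ?_⟩
    · have : Continuous fun δ : ℝ => ((1 + δ : ℝ) : ℂ) := by fun_prop
      simpa using (this.tendsto 0).mono_left nhdsWithin_le_nhds
    · filter_upwards [self_mem_nhdsWithin] with δ (hδ : 0 < δ)
      simpa using hδ.ne'
  have h1 : Tendsto (fun δ : ℝ =>
      ((((∑' n : ℕ, omegaCoeff n / n * Real.exp (-δ * Real.log n)) ^ 3 * δ ^ 2 : ℝ)) : ℂ))
      (𝓝[>] 0) (𝓝 ((constA : ℂ) ^ 3)) := by
    refine (hlim.comp hone).congr' ?_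
    filter_upwards [self_mem_nhdsWithin] with δ (hδ : 0 < δ)
    simp only [Function.comp]
    rw [hM _ (by simpa using hδ), omegaL, LSeries]
    simp_rw [← omegaCoeff_div_mul_exp_eq]
    rw [← Complex.ofReal_tsum]
    push_cast
    ring
  have h2 : Tendsto (fun δ : ℝ => (∑' n : ℕ, omegaCoeff n / n * Real.exp (-δ * Real.log n)) ^ 3 *
      δ ^ 2) (𝓝[>] 0) (𝓝 (constA ^ 3)) := by
    have := (Complex.continuous_re.tendsto _).comp h1
    rw [← Complex.ofReal_pow] at this
    simpa only [Function.comp_def, Complex.ofReal_re] using this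
  have h3 := h2.rpow_const (p := 1 / 3) (Or.inr (by norm_num))
  have hcube : ∀ a : ℝ, 0 ≤ a → (a ^ 3) ^ (1 / 3 : ℝ) = a := by
    intro a ha
    rw [← Real.rpow_natCast, ← Real.rpow_mul ha]
    norm_num
  rw [hcube _ constA_pos.le] at h3
  refine h3.congr' ?_
  filter_upwards [self_mem_nhdsWithin] with δ (hδ : 0 < δ)
  have hD : 0 ≤ ∑' n : ℕ, omegaCoeff n / n * Real.exp (-δ * Real.log n) :=
    tsum_nonneg fun n => by have := omegaCoeff_nonneg n; positivity
  rw [Real.mul_rpow (by positivity) (by positivity), hcube _ hD, mul_comm, ← Real.rpow_natCast δ,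
    ← Real.rpow_mul hδ.le]
  norm_num

/-- The logarithmic sums `∑ f(n) / n`, from the behaviour of `L(s)` as `s → 1⁺` along the reals. -/
lemma tendsto_sum_omegaCoeff_div :
    Tendsto (fun x : ℝ => (∑ n ∈ Finset.Icc 1 ⌊x⌋₊, omegaCoeff n / n) /
      Real.log x ^ (2 / 3 : ℝ)) atTop (𝓝 (constA / Real.Gamma (2 / 3 + 1))) := by
  have h := (tendsto_tsum_ite_div_rpow_of_tendsto_rpow_mul_tsum (α := 2 / 3)
    (w := fun n : ℕ => omegaCoeff n / n) (l := fun n : ℕ => Real.log n) (by norm_num)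
    (fun n => div_nonneg (omegaCoeff_nonneg n) (Nat.cast_nonneg n))
    (fun n => Real.log_natCast_nonneg n) (fun δ hδ => summable_omegaCoeff_div_mul_exp hδ)
    tendsto_rpow_mul_tsum_omegaCoeff).comp Real.tendsto_log_atTop
  refine h.congr' ?_
  filter_upwards [eventually_ge_atTop 1] with x hx
  simp only [Function.comp]
  congr 1
  have hiff : ∀ n : ℕ, n ≠ 0 → (Real.log n ≤ Real.log x ↔ n ∈ Finset.Icc 1 ⌊x⌋₊) := by
    intro n hn
    rw [Real.log_le_log_iff (by exact_mod_cast hn.bot_lt) (by linarith), Finset.mem_Icc,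
      Nat.le_floor_iff (by linarith)]
    exact ⟨fun h => ⟨Nat.one_le_iff_ne_zero.mpr hn, h⟩, fun h => h.2⟩
  rw [tsum_eq_sum (s := Finset.Icc 1 ⌊x⌋₊)]
  · refine Finset.sum_congr rfl fun n hn => ?_
    rw [if_pos ((hiff n (by have := (Finset.mem_Icc.mp hn).1; lia)).mpr hn)]
  · intro n hn
    rcases eq_or_ne n 0 with rfl | hn0
    -- the term at `n = 0` vanishes because of the division by zero
    · simp
    · rw [if_neg (fun h => hn ((hiff n hn0).mp h))]

/-- The Chebyshev function `∑_{n ≤ x} f(n) Λ(n)` weighted by `f(n) = (2/3)^Ω(n)`. -/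
def omegaPsi (x : ℝ) : ℝ :=
  ∑ n ∈ Finset.Ioc 0 ⌊x⌋₊, omegaCoeff n * ArithmeticFunction.vonMangoldt n

lemma omegaPsi_nonneg (x : ℝ) : 0 ≤ omegaPsi x :=
  Finset.sum_nonneg fun n _ =>
    mul_nonneg (omegaCoeff_nonneg n) ArithmeticFunction.vonMangoldt_nonneg

lemma omegaPsi_le (x : ℝ) : omegaPsi x ≤ 2 / 3 * Chebyshev.psi x := by
  rw [omegaPsi, Chebyshev.psi, Finset.mul_sum]
  refine Finset.sum_le_sum fun n hn => ?_
  have hΛ := ArithmeticFunction.vonMangoldt_nonneg (n := n)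
  rcases eq_or_ne n 1 with rfl | hn1
  · simp
  · refine mul_le_mul_of_nonneg_right ?_ hΛ
    have hn0 : n ≠ 0 := (Finset.mem_Ioc.mp hn).1.ne'
    have : ArithmeticFunction.cardFactors n ≠ 0 := by
      rw [Ne, ArithmeticFunction.cardFactors_eq_zero_iff_eq_zero_or_one]
      tauto
    calc omegaCoeff n ≤ (2 / 3 : ℝ) ^ 1 :=
          pow_le_pow_of_le_one (by norm_num) (by norm_num) (Nat.one_le_iff_ne_zero.mpr this)
      _ = 2 / 3 := pow_one _

lemma le_omegaPsi (x : ℝ) : 2 / 3 * Chebyshev.theta x ≤ omegaPsi x := by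
  rw [omegaPsi, Chebyshev.theta, Finset.mul_sum]
  refine (Finset.sum_le_sum fun p hp => ?_).trans (Finset.sum_le_sum_of_subset_of_nonneg
    (Finset.filter_subset _ _) fun n _ _ =>
      mul_nonneg (omegaCoeff_nonneg n) ArithmeticFunction.vonMangoldt_nonneg)
  have hp' := (Finset.mem_filter.mp hp).2
  rw [omegaCoeff_prime hp', ArithmeticFunction.vonMangoldt_apply_prime hp']

lemma tendsto_omegaPsi_div_self : Tendsto (fun x : ℝ => omegaPsi x / x) atTop (𝓝 (2 / 3)) := by
  have h1 := tendsto_theta_div_self.const_mul (2 / 3)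
  have h2 := tendsto_psi_div_self.const_mul (2 / 3)
  rw [mul_one] at h1 h2
  refine tendsto_of_tendsto_of_tendsto_of_le_of_le' h1 h2 ?_ ?_
  · filter_upwards [eventually_gt_atTop 0] with x hx
    rw [mul_div_assoc']
    exact div_le_div_of_nonneg_right (le_omegaPsi x) hx.le
  · filter_upwards [eventually_gt_atTop 0] with x hx
    rw [mul_div_assoc']
    exact div_le_div_of_nonneg_right (omegaPsi_le x) hx.le

lemma exists_abs_omegaPsi_sub_le {ε : ℝ} (hε : 0 < ε) :
    ∃ K, 0 ≤ K ∧ ∀ y, 0 ≤ y → |omegaPsi y - 2 / 3 * y| ≤ ε * y + K := by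
  obtain ⟨Y, hY⟩ := eventually_atTop.mp ((Metric.tendsto_nhds.mp tendsto_omegaPsi_div_self) ε hε)
  have hl4 : 0 < Real.log 4 := Real.log_pos (by norm_num)
  refine ⟨(Real.log 4 + 4) * max Y 1, by positivity, fun y hy => ?_⟩
  rcases le_total y (max Y 1) with h | h
  · have h1 := omegaPsi_nonneg y
    have h2 := omegaPsi_le y
    have h3 := Chebyshev.psi_le_const_mul_self hy
    have h4 : (Real.log 4 + 4) * y ≤ (Real.log 4 + 4) * max Y 1 := by gcongr
    have h5 := mul_nonneg hl4.le hy
    have h6 := mul_nonneg hε.le hy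
    rw [abs_le]
    constructor <;> nlinarith [Chebyshev.psi_nonneg y]
  · have hy0 : 0 < y := lt_of_lt_of_le (by positivity) h
    have h1 := hY y ((le_max_left _ _).trans h)
    have e : omegaPsi y - 2 / 3 * y = (omegaPsi y / y - 2 / 3) * y := by field_simp
    rw [Real.dist_eq] at h1
    rw [e, abs_mul, abs_of_pos hy0]
    have : 0 ≤ (Real.log 4 + 4) * max Y 1 := by positivity
    nlinarith

/-- As `f` is completely multiplicative, `f log = f * (f Λ)` under Dirichlet convolution. -/
lemma sum_omegaCoeff_mul_log (x : ℝ) :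
    ∑ n ∈ Finset.Icc 1 ⌊x⌋₊, omegaCoeff n * Real.log n =
      ∑ m ∈ Finset.Icc 1 ⌊x⌋₊, omegaCoeff m * omegaPsi (x / m) := by
  let f : ArithmeticFunction ℝ := ⟨fun n => if n = 0 then 0 else omegaCoeff n, if_pos rfl⟩
  let g : ArithmeticFunction ℝ :=
    ⟨fun n => omegaCoeff n * ArithmeticFunction.vonMangoldt n, by simp⟩
  have hf : ∀ n, n ≠ 0 → f n = omegaCoeff n := fun n hn => if_neg hn
  have hg : ∀ n, g n = omegaCoeff n * ArithmeticFunction.vonMangoldt n := fun n => rfl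
  have hfg : ∀ n, n ≠ 0 → (f * g) n = omegaCoeff n * Real.log n := by
    intro n hn
    rw [ArithmeticFunction.mul_apply, ← ArithmeticFunction.vonMangoldt_sum, Finset.mul_sum,
      Nat.sum_divisorsAntidiagonal' fun a b => f a * g b]
    refine Finset.sum_congr rfl fun d hd => ?_
    have hd' := Nat.dvd_of_mem_divisors hd
    obtain ⟨e, rfl⟩ := hd'
    have hd0 : d ≠ 0 := left_ne_zero_of_mul hn
    have he0 : e ≠ 0 := right_ne_zero_of_mul hn
    rw [Nat.mul_div_cancel_left e hd0.bot_lt, hf e he0, hg, omegaCoeff_mul hd0 he0]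
    ring
  have h := ArithmeticFunction.sum_Ioc_mul_eq_sum_sum f g ⌊x⌋₊
  rw [← Finset.Icc_add_one_left_eq_Ioc, zero_add] at h
  rw [Finset.sum_congr rfl fun n hn => (hfg n (by have := (Finset.mem_Icc.mp hn).1; lia)).symm, h]
  refine Finset.sum_congr rfl fun m hm => ?_
  rw [hf m (by have := (Finset.mem_Icc.mp hm).1; lia), omegaPsi, Nat.floor_div_natCast]
  rfl

/-- `∑_{n ≤ x} log (x / n) ≤ x`, which is `x ^ N / N! ≤ e ^ x` for `N = ⌊x⌋`. -/
lemma sum_log_div_le {x : ℝ} (hx : 0 < x) :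
    ∑ n ∈ Finset.Icc 1 ⌊x⌋₊, Real.log (x / n) ≤ x := by
  rw [← Real.log_prod (fun n hn => by
    have := (Finset.mem_Icc.mp hn).1
    have : (n : ℝ) ≠ 0 := by exact_mod_cast (by lia : n ≠ 0)
    positivity), Finset.prod_div_distrib, Finset.prod_const, Nat.card_Icc, Nat.add_sub_cancel,
    ← Nat.cast_prod, ← Finset.Ico_add_one_right_eq_Icc,
    Finset.prod_Ico_id_eq_factorial, Real.log_le_iff_le_exp (by positivity)]
  exact Real.pow_div_factorial_le_exp x hx.le _

/-- The passage from `∑ f(n) / n` to `∑ f(n)`: by the prime number theorem,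
`log x · ∑ f(n) = ∑ f(m) ψ_f(x / m) + O(x)` is asymptotic to `(2/3) x ∑ f(m) / m`. -/
lemma tendsto_sum_omegaCoeff_mul_log :
    Tendsto (fun x : ℝ => (∑ n ∈ Finset.Icc 1 ⌊x⌋₊, omegaCoeff n) * Real.log x /
      (x * Real.log x ^ (2 / 3 : ℝ))) atTop (𝓝 (constA / Real.Gamma (2 / 3))) := by
  set S : ℝ → ℝ := fun x => ∑ n ∈ Finset.Icc 1 ⌊x⌋₊, omegaCoeff n with hS
  set T : ℝ → ℝ := fun x => ∑ n ∈ Finset.Icc 1 ⌊x⌋₊, omegaCoeff n / n with hT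
  have hTlim := tendsto_sum_omegaCoeff_div
  have hSx : ∀ x, 0 < x → S x ≤ x := by
    intro x hx
    calc S x ≤ ∑ n ∈ Finset.Icc 1 ⌊x⌋₊, (1 : ℝ) := Finset.sum_le_sum fun n _ => omegaCoeff_le_one n
      _ = ⌊x⌋₊ := by simp
      _ ≤ x := Nat.floor_le hx.le
  have hbound : ∀ ε > 0, ∃ K, 0 ≤ K ∧ ∀ x, 0 < x →
      |S x * Real.log x - 2 / 3 * (x * T x)| ≤ ε * (x * T x) + K * x := by
    intro ε hε
    obtain ⟨K, hK0, hK⟩ := exists_abs_omegaPsi_sub_le hε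
    refine ⟨K + 1, by linarith, fun x hx => ?_⟩
    have e1 : S x * Real.log x = ∑ m ∈ Finset.Icc 1 ⌊x⌋₊, omegaCoeff m * omegaPsi (x / m) +
        ∑ n ∈ Finset.Icc 1 ⌊x⌋₊, omegaCoeff n * Real.log (x / n) := by
      rw [← sum_omegaCoeff_mul_log, ← Finset.sum_add_distrib, hS, Finset.sum_mul]
      refine Finset.sum_congr rfl fun n hn => ?_
      have : (n : ℝ) ≠ 0 := by
        have := (Finset.mem_Icc.mp hn).1
        exact_mod_cast (by lia : n ≠ 0)
      rw [Real.log_div hx.ne' this]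
      ring
    have e2 : x * T x = ∑ m ∈ Finset.Icc 1 ⌊x⌋₊, omegaCoeff m * (x / m) := by
      rw [hT, Finset.mul_sum]
      exact Finset.sum_congr rfl fun n _ => by ring
    have h1 : |∑ m ∈ Finset.Icc 1 ⌊x⌋₊, omegaCoeff m * omegaPsi (x / m) - 2 / 3 * (x * T x)| ≤
        ε * (x * T x) + K * S x := by
      rw [e2, Finset.mul_sum, ← Finset.sum_sub_distrib, hS, Finset.mul_sum, Finset.mul_sum,
        ← Finset.sum_add_distrib]
      refine (Finset.abs_sum_le_sum_abs _ _).trans (Finset.sum_le_sum fun m _ => ?_)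
      have := hK (x / m) (by positivity)
      calc |omegaCoeff m * omegaPsi (x / m) - 2 / 3 * (omegaCoeff m * (x / m))|
          = omegaCoeff m * |omegaPsi (x / m) - 2 / 3 * (x / m)| := by
            rw [← abs_of_nonneg (omegaCoeff_nonneg m), ← abs_mul, abs_of_nonneg
              (omegaCoeff_nonneg m)]
            congr 1
            ring
        _ ≤ omegaCoeff m * (ε * (x / m) + K) := by
            have := omegaCoeff_nonneg m
            gcongr
        _ = _ := by ring
    have hlog : ∀ n ∈ Finset.Icc 1 ⌊x⌋₊, 0 ≤ Real.log (x / n) := by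
      intro n hn
      obtain ⟨h1, h2⟩ := Finset.mem_Icc.mp hn
      refine Real.log_nonneg ?_
      rw [one_le_div (by exact_mod_cast h1)]
      exact (Nat.le_floor_iff hx.le).mp h2
    have h2 : 0 ≤ ∑ n ∈ Finset.Icc 1 ⌊x⌋₊, omegaCoeff n * Real.log (x / n) :=
      Finset.sum_nonneg fun n hn => mul_nonneg (omegaCoeff_nonneg n) (hlog n hn)
    have h3 : ∑ n ∈ Finset.Icc 1 ⌊x⌋₊, omegaCoeff n * Real.log (x / n) ≤ x :=
      (Finset.sum_le_sum fun n hn => mul_le_of_le_one_left (hlog n hn)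
        (omegaCoeff_le_one n)).trans (sum_log_div_le hx)
    have h4 : K * S x ≤ K * x := by gcongr; exact hSx x hx
    rw [e1]
    rw [abs_le] at h1 ⊢
    constructor <;> nlinarith
  have hpow : Tendsto (fun x : ℝ => Real.log x ^ (2 / 3 : ℝ)) atTop atTop :=
    (tendsto_rpow_atTop (by norm_num)).comp Real.tendsto_log_atTop
  have hdiff : Tendsto (fun x : ℝ => S x * Real.log x / (x * Real.log x ^ (2 / 3 : ℝ)) -
      2 / 3 * (T x / Real.log x ^ (2 / 3 : ℝ))) atTop (𝓝 0) := by
    rw [Metric.tendsto_nhds]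
    intro ε hε
    set c := constA / Real.Gamma (2 / 3 + 1) with hc
    have hc0 : 0 < c := div_pos constA_pos (Real.Gamma_pos_of_pos (by norm_num))
    obtain ⟨κ, hκ⟩ : ∃ κ, κ = ε / (2 * (c + 1)) := ⟨_, rfl⟩
    have hκ0 : 0 < κ := by rw [hκ]; positivity
    obtain ⟨K, hK0, hK⟩ := hbound κ hκ0
    filter_upwards [hTlim.eventually_lt_const (lt_add_one c),
      hpow.eventually_gt_atTop (2 * K / ε), eventually_gt_atTop 1] with x h1 h2 hx1
    have hx : 0 < x := by linarith
    have hl : 0 < Real.log x ^ (2 / 3 : ℝ) := Real.rpow_pos_of_pos (Real.log_pos hx1) _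
    set l := Real.log x ^ (2 / 3 : ℝ)
    have e : S x * Real.log x / (x * l) - 2 / 3 * (T x / l) =
        (S x * Real.log x - 2 / 3 * (x * T x)) / (x * l) := by field_simp
    rw [Real.dist_eq, sub_zero, e, abs_div, abs_of_pos (mul_pos hx hl)]
    have h3 : K / l < ε / 2 := by
      rw [div_lt_iff₀ hε] at h2
      rw [div_lt_div_iff₀ hl (by norm_num)]
      linarith
    calc _ ≤ (κ * (x * T x) + K * x) / (x * l) := by gcongr; exact hK x hx
      _ = κ * (T x / l) + K / l := by field_simp
      _ < κ * (c + 1) + ε / 2 := by gcongr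
      _ = ε := by rw [hκ]; field_simp; ring
  have h := hdiff.add (hTlim.const_mul (2 / 3))
  have hval : (0 : ℝ) + 2 / 3 * (constA / Real.Gamma (2 / 3 + 1)) =
      constA / Real.Gamma (2 / 3) := by
    rw [Real.Gamma_add_one (by norm_num)]
    have := (Real.Gamma_pos_of_pos (show (0 : ℝ) < 2 / 3 by norm_num)).ne'
    field_simp
    ring
  rw [hval] at h
  exact h.congr fun x => by simp only [hS, hT, sub_add_cancel]

lemma sum_omegaCoeff_isEquivalent :
    (fun X : ℝ => ∑ n ∈ Finset.Icc 1 ⌊X⌋₊, omegaCoeff n) ~[atTop]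
      (fun X : ℝ => constA / Real.Gamma (2 / 3) * (X / Real.log X ^ (1 / 3 : ℝ))) := by
  have hc : 0 < constA / Real.Gamma (2 / 3) :=
    div_pos constA_pos (Real.Gamma_pos_of_pos (by norm_num))
  rw [isEquivalent_iff_tendsto_one]
  · have h := tendsto_sum_omegaCoeff_mul_log.div_const (constA / Real.Gamma (2 / 3))
    rw [div_self hc.ne'] at h
    refine h.congr' ?_
    filter_upwards [eventually_gt_atTop 1] with x hx
    have hl : 0 < Real.log x := Real.log_pos hx
    have h1 : 0 < Real.log x ^ (1 / 3 : ℝ) := Real.rpow_pos_of_pos hl _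
    have h2 : 0 < Real.log x ^ (2 / 3 : ℝ) := Real.rpow_pos_of_pos hl _
    have h3 : Real.log x = Real.log x ^ (1 / 3 : ℝ) * Real.log x ^ (2 / 3 : ℝ) := by
      rw [← Real.rpow_add hl]
      norm_num
    have hx0 : 0 < x := by linarith
    simp only [Pi.div_apply]
    generalize constA / Real.Gamma (2 / 3) = c at *
    nth_rewrite 1 [h3]
    field_simp
  · filter_upwards [eventually_gt_atTop 1] with x hx
    have : 0 < Real.log x := Real.log_pos hx
    positivity

end

theorem mainTheorem3 :
    -- the Dirichlet series converges absolutely for `Re s > 1`, is holomorphic there,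
    -- and has the Euler product
    (∀ s : ℂ, 1 < s.re →
      LSeriesSummable (fun n => (omegaCoeff n : ℂ)) s ∧
      HasProd (fun p : Nat.Primes => (1 - 2 / 3 * ((p : ℕ) : ℂ) ^ (-s))⁻¹) (omegaL s)) ∧
    DifferentiableOn ℂ omegaL {s : ℂ | 1 < s.re} ∧
    -- `L ^ 3` continues meromorphically to `Re s > 1/2`, with only a pole, of order 2, at `s = 1`
    (∃ M : ℂ → ℂ,
      (∀ s : ℂ, 1 < s.re → M s = omegaL s ^ 3) ∧
      MeromorphicOn M {s : ℂ | 1 / 2 < s.re} ∧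
      DifferentiableOn ℂ M ({s : ℂ | 1 / 2 < s.re} \ {1}) ∧
      meromorphicOrderAt M 1 = ((-2 : ℤ) : WithTop ℤ) ∧
      Tendsto (fun s : ℂ => M s * (s - 1) ^ 2) (𝓝[≠] 1) (𝓝 ((constA : ℂ) ^ 3))) ∧
    -- the product in the definition of `A` converges, to a positive limit
    Multipliable eulerFactor ∧
    0 < ∏' p : Nat.Primes, eulerFactor p ∧
    -- the asymptotic formula
    (fun X : ℝ => ∑ n ∈ Finset.Icc 1 ⌊X⌋₊, omegaCoeff n) ~[atTop]
      (fun X : ℝ => constA / Real.Gamma (2 / 3) * (X / Real.log X ^ (1 / 3 : ℝ))) := by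
  exact ⟨fun s hs => ⟨LSeriesSummable_omegaCoeff hs, hasProd_omegaL hs⟩, differentiableOn_omegaL,
    exists_meromorphic_continuation, multipliable_eulerFactor, tprod_eulerFactor_pos,
    sum_omegaCoeff_isEquivalent⟩
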